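/- Let $K\ge 1$ be an integer (the number of colours). For $1\le i\le K$ let $b_{i0},b_{i1},b_{i2},\dots$ be non-negative reals with $b_{i0}>0$, $b_{i1}>0$, and assume that the power series $B_i(\theta)=\sum_{k\ge 0} b_{ik}\theta^k/k!$ has radius of convergence $R_i\in(0,\infty]$. For $\theta>0$ with $B_i(\theta)<\infty$ let $\xi_i(\theta)$ be a random variable with $P\{\xi_i(\theta)=k\}=\dfrac{b_{ik}\theta^k}{k!\,B_i(\theta)}$, $k=0,1,2,\dots$. For $0<\theta<R_i$ put $m_i(\theta)=E\,\xi_i(\theta)$; this is a strictly increasing function of $\theta\in(0,R_i)$, and $m_i^{-1}$ denotes its inverse. For $\mathbf n=(n_1,\dots,n_K)\in\mathbb N^K$ and $N\in\mathbb N$ let $\eta_1,\dots,\eta_N$ (depending on $\mathbf n,N$) be random vectors with values in $\mathbb N^K$ which obey the multi-colour generalized allocation scheme: whenever $\mathbf k_j=(k_{1j},\dots,k_{Kj})\in\mathbb N^K$, $1\le j\le N$, satisfy $k_{i1}+\dots+k_{iN}=n_i$ for $1\le i\le K$, $$P\{\eta_1=\mathbf k_1,\dots,\eta_N=\mathbf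 k_N\}=\prod_{i=1}^K P\{\xi_{i1}=k_{i1},\dots,\xi_{iN}=k_{iN}\mid \xi_{i1}+\dots+\xi_{iN}=n_i\},$$ where $\xi_{i1},\dots,\xi_{iN}$ are independent copies of $\xi_i(\theta_i)$ for some $\theta_i>0$ with $B_i(\theta_i)<\infty$ (which may depend on $\mathbf n$ and $N$). This is required for those $(\mathbf n,N)$ for which the conditioning events have positive probability. All these random vectors are defined on one probability space, and nothing is assumed on their joint distribution for different $(\mathbf n,N)$. For $\mathbf s=(s_1,\dots,s_K)\in\mathbb N^K$ let $$\mu_{\mathbf s\mathbf nN}=\sum_{j=1}^N \mathbb I_{\{\eta_j=\mathbf s\}}$$ be the number of boxes containing exactly $s_i$ balls of colour $i$ for every $1\le i\le K$. With $\alpha_i=n_i/N$ and $\theta_{i\alpha_i}=m_i^{-1}(\alpha_i)$ put $$p_{\mathbf s\mathbf nN}=\prod_{i=1}^K\frac{b_{is_i}\theta_{i\alpha_i}^{s_i}}{s_i!\,B_i(\theta_{i\alpha_i})},\qquad \sigma^2_{\mathbf s\mathbf nN}=p_{\mathbf s\mathbf nN}(1-p_{\mathbf s\mathbf nN}).$$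 **Theorem.** Let $0<\alpha_i'<\alpha_i''$ be such that $m_i^{-1}(\alpha_i'')$ exists and $m_i^{-1}(\alpha_i'')<R_i$, $1\le i\le K$. Let $\mathbf s\in\mathbb N^K$ be fixed with $b_{is_i}>0$, $1\le i\le K$. Then $$\limsup_{\substack{\mathbf n\to\infty,\ N\to\infty\\ \alpha_i'<\alpha_i<\alpha_i'',\ 1\le i\le K}}\frac{|\mu_{\mathbf s\mathbf nN}-E\mu_{\mathbf s\mathbf nN}|}{\sqrt{N\ln N}\,\sigma_{\mathbf s\mathbf nN}}\le 4\sqrt{1+\frac{3K}{2}}\qquad\text{almost surely.}$$ -/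

import Mathlib

open MeasureTheory Filter
open scoped Nat ENNReal

noncomputable section

namespace MultiColour

/-- The series `B(θ) = ∑ b_k θ^k / k!`. -/
def seriesB (b : ℕ → ℝ) (θ : ℝ) : ℝ := ∑' k : ℕ, b k * θ ^ k / (k ! : ℝ)

/-- The radius of convergence of the power series `∑ (b_k / k!) θ^k`. -/
def radius (b : ℕ → ℝ) : ℝ≥0∞ :=
  (FormalMultilinearSeries.ofScalars ℝ (fun k : ℕ => b k / (k ! : ℝ))).radius

/-- The weight `b_k θ^k / (k! B(θ))` of the power-series distribution. -/
def weight (b : ℕ → ℝ) (θ : ℝ) (k : ℕ) : ℝ := b k * θ ^ k / ((k ! : ℝ) * seriesB b θ)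

/-- The power-series distribution: the law of `ξ(θ)`, a measure on `ℕ`. -/
def law (b : ℕ → ℝ) (θ : ℝ) : Measure ℕ :=
  Measure.sum fun k : ℕ => ENNReal.ofReal (weight b θ k) • Measure.dirac k

/-- The expectation `m(θ)` of `ξ(θ)`. -/
def mean (b : ℕ → ℝ) (θ : ℝ) : ℝ := ∫ k, (k : ℝ) ∂(law b θ)

/-- The parameter interval `(0, R)`, where `R` is the radius of convergence (possibly `∞`). -/
def paramSet (b : ℕ → ℝ) : Set ℝ := {θ : ℝ | 0 < θ ∧ ENNReal.ofReal θ < radius b}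

/-- The inverse function of `m` on `(0, R)`. -/
def meanInv (b : ℕ → ℝ) (α : ℝ) : ℝ := Function.invFunOn (mean b) (paramSet b) α

/-- The event `x_1 + ⋯ + x_N = n` on the canonical space of `N` integer-valued variables. -/
def sumEvent (N n : ℕ) : Set (Fin N → ℕ) := {x | ∑ j, x j = n}

/-- The random vectors `η_1, …, η_N` obey the multi-colour generalized allocation scheme with
`n i` balls of colour `i`, built from independent variables `ξ_{ij}` with laws `ν i j`
(so the joint law of `ξ_{i1}, …, ξ_{iN}` is the product measure of the `ν i j`):
`P{η_1 = k_1, …, η_N = k_N} = ∏_i P{ξ_{i1} = k_{i1}, …, ξ_{iN} = k_{iN} | ∑_j ξ_{ij} = n_i}`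
whenever `∑_j k_{ij} = n_i` for every `i`. -/
structure IsScheme {Ω : Type*} [MeasurableSpace Ω] (P : Measure Ω) {K N : ℕ}
    (ν : Fin K → Fin N → Measure ℕ) (n : Fin K → ℕ) (η : Fin N → Ω → (Fin K → ℕ)) : Prop where
  measurable : ∀ j, Measurable (η j)
  joint_law : ∀ k : Fin N → Fin K → ℕ, (∀ i, ∑ j, k j i = n i) →
    P {ω | ∀ j, η j ω = k j} =
      ∏ i, ProbabilityTheory.cond (Measure.pi (ν i)) (sumEvent N (n i)) {x | ∀ j, x j = k j i}

/-- The number of boxes whose content is exactly the vector `s`. -/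
def boxCount {Ω : Type*} {K N : ℕ} (η : Fin N → Ω → (Fin K → ℕ)) (s : Fin K → ℕ) (ω : Ω) : ℝ :=
  ∑ j, Set.indicator {ω' | η j ω' = s} (fun _ => (1 : ℝ)) ω

/-- `p_{snN} = ∏_i b_{i s_i} θ_i^{s_i} / (s_i! B_i(θ_i))` with `θ_i = m_i⁻¹(n_i / N)`. -/
def cellProb {K : ℕ} (b : Fin K → ℕ → ℝ) (s n : Fin K → ℕ) (N : ℕ) : ℝ :=
  ∏ i, weight (b i) (meanInv (b i) ((n i : ℝ) / (N : ℝ))) (s i)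

/-- `σ_{snN} = √(p_{snN} (1 - p_{snN}))`. -/
def cellSigma {K : ℕ} (b : Fin K → ℕ → ℝ) (s n : Fin K → ℕ) (N : ℕ) : ℝ :=
  √(cellProb b s n N * (1 - cellProb b s n N))

/-- The filter for `n → ∞`, `N → ∞` within the sector `α'_i < n_i / N < α''_i`. -/
def sector {K : ℕ} (α' α'' : Fin K → ℝ) : Filter ((Fin K → ℕ) × ℕ) :=
  atTop ⊓ 𝓟 {q | ∀ i, α' i < (q.1 i : ℝ) / (q.2 : ℝ) ∧ (q.1 i : ℝ) / (q.2 : ℝ) < α'' i}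

end MultiColour

end

noncomputable section

namespace MultiColour

open ProbabilityTheory

/-! Conditioning on a sum does not depend on the parameter of a power-series law, so every colour
may be given the parameter `θ_α`, for which the sum has mean exactly `n_i` (`cond_pi_law_eq`). The
scheme is then an array of i.i.d. boxes conditioned on `K` independent events. If each event has
probability at least `1/N`, conditioning raises probabilities by a factor of at most `N^K`
(`IsScheme.measureReal_le`).

For independent boxes `μ` is binomial with success probability `p`. With `ε² = 9(K+1)/2`,
Bernstein's inequality bounds the probability of `|μ - Np| ≥ ε √(N ln N) σ` by `2 N^{-(2K+2)}`,
hence by `2 N^{-(K+2)}` in the scheme. The sector contains `O(N^K)` vectors `n` for each `N`, so the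
union over them has probability `O(N^{-2})`, and Borel–Cantelli applies without any assumption on
joint laws. The same tail puts `Eμ` within `ε √(N ln N) σ + 2` of `Np`; the triangle inequality
gives the constant `2ε`, which is less than `4 √(1 + 3K/2)` for `K ≥ 1`.

The bound `P(S_N = n) ≥ 1/N`, uniform over the sector, is obtained without Fourier analysis
(`exists_forall_inv_le_sumProb`). The number of coordinates equal to `a` concentrates near `N ν{a}`,
even after restriction to a sum event, up to a small error. Deleting one such coordinate therefore
compares `P(S_N = m + a)` with `P(S_{N-1} = m)`. Using `a = 0` and `a = 1` shows that neighbouring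
values of `P(S_N = ·)` have ratio close to one, up to an additive error. Chebyshev's inequality
places half of the mass on `O(√N)` values around `n`, and chaining the ratios carries this mass to
`n` itself. -/

/-! ### Exponential moments and Bernstein's inequality -/

theorem exp_le_quadratic {y l : ℝ} (hl : l ≤ 1) (hy : |y| ≤ l) :
    Real.exp y ≤ 1 + y + y ^ 2 * ((1 + l) / 2) := by
  -- The Taylor remainder is at most `(2/9)|y|³`, which is below `y² l / 2`.
  have h := Real.exp_bound (hy.trans hl) (n := 3) (by norm_num)
  simp only [Finset.sum_range_succ, Finset.sum_range_zero] at h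
  norm_num [Nat.factorial] at h
  have h1 := (abs_le.1 h).2
  have h2 : |y| ^ 3 ≤ y ^ 2 * l := by
    rw [← sq_abs y, pow_succ]
    exact mul_le_mul_of_nonneg_left hy (by positivity)
  nlinarith [mul_nonneg (sq_nonneg y) ((abs_nonneg y).trans hy)]

theorem mgf_le_of_abs_le_one {E : Type*} [MeasurableSpace E] {κ : Measure E}
    [IsProbabilityMeasure κ] {X : E → ℝ} (hX : Measurable X) (hX1 : ∀ x, |X x| ≤ 1)
    (h0 : ∫ x, X x ∂κ = 0) {l : ℝ} (hl0 : 0 ≤ l) (hl1 : l ≤ 1) :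
    mgf X κ l ≤ Real.exp (l ^ 2 * (∫ x, X x ^ 2 ∂κ) * ((1 + l) / 2)) := by
  have hint : Integrable X κ := Integrable.of_bound hX.aestronglyMeasurable 1
    (Eventually.of_forall fun x => by simpa using hX1 x)
  have hint2 : Integrable (fun x => X x ^ 2) κ :=
    Integrable.of_bound (hX.pow_const 2).aestronglyMeasurable 1
      (Eventually.of_forall fun x => by simpa using hX1 x)
  have hexp : Integrable (fun x => Real.exp (l * X x)) κ :=
    Integrable.of_bound (by fun_prop) (Real.exp 1) (Eventually.of_forall fun x => by
      rw [Real.norm_eq_abs, Real.abs_exp, Real.exp_le_exp]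
      nlinarith [(abs_le.1 (hX1 x)).2])
  have hle : ∀ x, Real.exp (l * X x) ≤
      1 + l * X x + (l ^ 2 * ((1 + l) / 2)) * X x ^ 2 := fun x => by
    have := exp_le_quadratic (y := l * X x) hl1 (by
      rw [abs_mul, abs_of_nonneg hl0]; nlinarith [hX1 x])
    linarith [mul_pow l (X x) 2, this, congrArg (· * ((1 + l) / 2)) (mul_pow l (X x) 2)]
  calc mgf X κ l ≤ ∫ x, (1 + l * X x + (l ^ 2 * ((1 + l) / 2)) * X x ^ 2) ∂κ :=
        integral_mono hexp (((integrable_const _).add (hint.const_mul _)).add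
          (hint2.const_mul _)) hle
    _ = 1 + l ^ 2 * (∫ x, X x ^ 2 ∂κ) * ((1 + l) / 2) := by
        rw [integral_add (f := fun x => 1 + l * X x)
            ((integrable_const _).add (hint.const_mul _)) (hint2.const_mul _),
          integral_add (integrable_const _) (hint.const_mul _), integral_const_mul,
          integral_const_mul, h0]
        simp; ring
    _ ≤ _ := by linarith [Real.add_one_le_exp (l ^ 2 * (∫ x, X x ^ 2 ∂κ) * ((1 + l) / 2))]

theorem measureReal_sum_ge_le {E : Type*} [MeasurableSpace E] {κ : Measure E}
    [IsProbabilityMeasure κ] {X : E → ℝ} (hX : Measurable X) (hX1 : ∀ x, |X x| ≤ 1)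
    (h0 : ∫ x, X x ∂κ = 0) {l : ℝ} (hl0 : 0 ≤ l) (hl1 : l ≤ 1) (N : ℕ) (t : ℝ) :
    (Measure.pi fun _ : Fin N => κ).real {x | t ≤ ∑ j, X (x j)} ≤
      Real.exp (-(l * t) + N * (l ^ 2 * (∫ x, X x ^ 2 ∂κ) * ((1 + l) / 2))) := by
  have hb : ∀ x : Fin N → E, |∑ j, X (x j)| ≤ N := fun x =>
    (Finset.abs_sum_le_sum_abs _ _).trans
      ((Finset.sum_le_sum fun j _ => hX1 (x j)).trans (by simp))
  have hm : Measurable fun x : Fin N → E => ∑ j, X (x j) := by fun_prop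
  have hexp : Integrable (fun x : Fin N → E => Real.exp (l * ∑ j, X (x j)))
      (Measure.pi fun _ : Fin N => κ) :=
    Integrable.of_bound (Real.measurable_exp.comp (hm.const_mul l)).aestronglyMeasurable
      (Real.exp N) (Eventually.of_forall fun x => by
      rw [Real.norm_eq_abs, Real.abs_exp, Real.exp_le_exp]
      have := abs_le.1 (hb x)
      have hN : (0 : ℝ) ≤ N := by positivity
      nlinarith)
  have hind : iIndepFun (fun (j : Fin N) (x : Fin N → E) => X (x j))
      (Measure.pi fun _ : Fin N => κ) :=
    iIndepFun_pi (X := fun _ => X) fun _ => hX.aemeasurable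
  have hmgf : mgf (fun x : Fin N → E => ∑ j, X (x j)) (Measure.pi fun _ : Fin N => κ) l =
      mgf X κ l ^ N := by
    have h1 := hind.mgf_sum (t := l) (fun j => hX.comp (measurable_pi_apply j)) Finset.univ
    have h2 : (∑ j : Fin N, fun x : Fin N → E => X (x j)) = fun x => ∑ j, X (x j) := by
      ext x; simp
    rw [h2] at h1
    rw [h1]
    have h3 : ∀ j : Fin N, mgf (fun x : Fin N → E => X (x j))
        (Measure.pi fun _ : Fin N => κ) l = mgf X κ l := fun j => by
      have hp := measurePreserving_eval (fun _ : Fin N => κ) j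
      have h4 := integral_map (μ := Measure.pi fun _ : Fin N => κ)
        hp.measurable.aemeasurable (f := fun y => Real.exp (l * X y)) (by fun_prop)
      rw [hp.map_eq] at h4
      exact h4.symm
    simp [h3]
  refine (measure_ge_le_exp_mul_mgf t hl0 hexp).trans ?_
  rw [hmgf, Real.exp_add, neg_mul]
  refine mul_le_mul_of_nonneg_left ?_ (Real.exp_nonneg _)
  rw [Real.exp_nat_mul]
  exact pow_le_pow_left₀ mgf_nonneg (mgf_le_of_abs_le_one hX hX1 h0 hl0 hl1) N

/-- The number of coordinates of `x` which lie in `A`. -/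
def hitCount {E : Type*} {N : ℕ} (A : Set E) (x : Fin N → E) : ℝ :=
  ∑ j, A.indicator (fun _ => (1 : ℝ)) (x j)

theorem hitCount_nonneg {E : Type*} {N : ℕ} (A : Set E) (x : Fin N → E) : 0 ≤ hitCount A x :=
  Finset.sum_nonneg fun _ _ => Set.indicator_nonneg (fun _ _ => zero_le_one) _

theorem hitCount_le {E : Type*} {N : ℕ} (A : Set E) (x : Fin N → E) : hitCount A x ≤ N := by
  refine (Finset.sum_le_sum fun j _ =>
    Set.indicator_le_self' (fun _ _ => zero_le_one) (x j)).trans (by simp)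

theorem measurable_hitCount {E : Type*} [MeasurableSpace E] {N : ℕ} {A : Set E}
    (hA : MeasurableSet A) : Measurable (hitCount A : (Fin N → E) → ℝ) := by
  unfold hitCount
  exact Finset.measurable_sum _ fun j _ =>
    (measurable_const.indicator hA).comp (measurable_pi_apply j)

/-- A Bernstein type inequality for the number of hits of a set by independent variables. -/
theorem measureReal_abs_hitCount_sub_ge_le {E : Type*} [MeasurableSpace E] (κ : Measure E)
    [IsProbabilityMeasure κ] {A : Set E} (hA : MeasurableSet A) {l : ℝ} (hl0 : 0 ≤ l)
    (hl1 : l ≤ 1) (N : ℕ) (t : ℝ) :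
    (Measure.pi fun _ : Fin N => κ).real {x | t ≤ |hitCount A x - N * κ.real A|} ≤
      2 * Real.exp (-(l * t) + N * (l ^ 2 * (κ.real A * (1 - κ.real A)) * ((1 + l) / 2))) := by
  set p := κ.real A with hp
  have hp0 : 0 ≤ p := measureReal_nonneg
  have hp1 : p ≤ 1 := measureReal_le_one
  set I : E → ℝ := A.indicator (fun _ => (1 : ℝ)) with hI
  have hIm : Measurable I := measurable_const.indicator hA
  have hII : Integrable I κ := (integrable_const 1).indicator hA
  have hIp : ∫ x, I x ∂κ = p := by simp [hI, integral_indicator hA, hp]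
  have hI01 : ∀ x, I x = 0 ∨ I x = 1 := fun x => by
    by_cases hx : x ∈ A <;> simp [hI, hx]
  have hv : ∫ x, (I x - p) ^ 2 ∂κ = p * (1 - p) := by
    have : ∀ x, (I x - p) ^ 2 = (1 - 2 * p) * I x + p ^ 2 := fun x => by
      rcases hI01 x with h | h <;> rw [h] <;> ring
    simp_rw [this]
    rw [integral_add (hII.const_mul _) (integrable_const _), integral_const_mul, hIp]
    simp; ring
  have hb : ∀ x, |I x - p| ≤ 1 := fun x => by
    rw [abs_le]; rcases hI01 x with h | h <;> rw [h] <;> constructor <;> linarith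
  have h1 := measureReal_sum_ge_le (κ := κ) (X := fun x => I x - p) (hIm.sub_const p) hb
    (by rw [integral_sub hII (integrable_const _), hIp]; simp) hl0 hl1 N t
  have h2 := measureReal_sum_ge_le (κ := κ) (X := fun x => -(I x - p)) (hIm.sub_const p).neg
    (fun x => by rw [abs_neg]; exact hb x)
    (by rw [integral_neg, integral_sub hII (integrable_const _), hIp]; simp) hl0 hl1 N t
  simp only [neg_sq] at h2
  rw [hv] at h1 h2
  have hs : ∀ x : Fin N → E, ∑ j, (I (x j) - p) = hitCount A x - N * p := fun x => by
    simp [hitCount, Finset.sum_sub_distrib, hI]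
  refine (measureReal_mono (s₂ := {x | t ≤ ∑ j, (I (x j) - p)} ∪ {x | t ≤ ∑ j, -(I (x j) - p)})
    ?_).trans ((measureReal_union_le _ _).trans (by linarith))
  intro x hx
  simp only [Set.mem_union, Set.mem_ofPred_eq, Finset.sum_neg_distrib, hs] at hx ⊢
  exact le_abs.1 hx

/-! ### Integrals of concentrated bounded variables -/

/-- Pointwise, `Z` is below `c + d` off the deviation event and below `N` on it. Keeping the set `S`
arbitrary lets the estimate be used on a sum event. -/
theorem setIntegral_le_of_concentrated {X : Type*} [MeasurableSpace X] {μ : Measure X}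
    [IsProbabilityMeasure μ] {Z : X → ℝ} (hZ : Measurable Z) {N c d : ℝ} (hZ0 : ∀ x, 0 ≤ Z x)
    (hZN : ∀ x, Z x ≤ N) (hc : 0 ≤ c) (hd : 0 ≤ d) {S : Set X} (hS : MeasurableSet S) :
    ∫ x in S, Z x ∂μ ≤ (c + d) * μ.real S + N * μ.real {x | d ≤ |Z x - c|} := by
  have hB : MeasurableSet {x | d ≤ |Z x - c|} :=
    measurableSet_le measurable_const (hZ.sub_const c).abs
  rw [← integral_indicator hS, ← integral_indicator_one hS, ← integral_indicator_one hB,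
    ← integral_const_mul, ← integral_const_mul, ← integral_add]
  · refine integral_mono ?_ ?_ fun x => ?_
    · exact (Integrable.of_bound hZ.aestronglyMeasurable N (Eventually.of_forall fun x => by
        rw [Real.norm_eq_abs, abs_of_nonneg (hZ0 x)]; exact hZN x)).indicator hS
    · exact (((integrable_const (1 : ℝ)).indicator hS).const_mul _).add
        (((integrable_const (1 : ℝ)).indicator hB).const_mul _)
    · have h0 := hZ0 x
      have h1 := hZN x
      by_cases hx : x ∈ S <;> by_cases hy : d ≤ |Z x - c| <;>
        simp [hx, hy]
      · linarith
      · linarith [le_abs_self (Z x - c)]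
      · linarith
  · exact ((integrable_const (1 : ℝ)).indicator hS).const_mul _
  · exact ((integrable_const (1 : ℝ)).indicator hB).const_mul _

theorem le_setIntegral_of_concentrated {X : Type*} [MeasurableSpace X] {μ : Measure X}
    [IsProbabilityMeasure μ] {Z : X → ℝ} (hZ : Measurable Z) {N c d : ℝ} (hZ0 : ∀ x, 0 ≤ Z x)
    (hZN : ∀ x, Z x ≤ N) (hcN : c ≤ N) (hd : 0 ≤ d) {S : Set X} (hS : MeasurableSet S) :
    (c - d) * μ.real S ≤ ∫ x in S, Z x ∂μ + N * μ.real {x | d ≤ |Z x - c|} := by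
  have hB : MeasurableSet {x | d ≤ |Z x - c|} :=
    measurableSet_le measurable_const (hZ.sub_const c).abs
  have hZi : Integrable (S.indicator Z) μ :=
    (Integrable.of_bound hZ.aestronglyMeasurable N (Eventually.of_forall fun x => by
        rw [Real.norm_eq_abs, abs_of_nonneg (hZ0 x)]; exact hZN x)).indicator hS
  rw [← integral_indicator hS, ← integral_indicator_one hS, ← integral_indicator_one hB,
    ← integral_const_mul, ← integral_const_mul, ← integral_add hZi]
  · refine integral_mono ?_ ?_ fun x => ?_
    · exact ((integrable_const (1 : ℝ)).indicator hS).const_mul _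
    · exact hZi.add (((integrable_const (1 : ℝ)).indicator hB).const_mul _)
    · have h0 := hZ0 x
      have h1 := hZN x
      by_cases hx : x ∈ S <;> by_cases hy : d ≤ |Z x - c| <;>
        simp [hx, hy]
      · linarith
      · linarith [neg_abs_le (Z x - c)]
      · linarith
  · exact ((integrable_const (1 : ℝ)).indicator hB).const_mul _

/-! ### A local lower bound for sums of independent variables -/

/-- The probability that `N` independent variables of law `ν` have the sum `m`. -/
def sumProb (ν : Measure ℕ) (N m : ℕ) : ℝ := (Measure.pi fun _ : Fin N => ν).real (sumEvent N m)

theorem measurableSet_sumEvent (N m : ℕ) : MeasurableSet (sumEvent N m) :=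
  (Set.to_countable _).measurableSet

theorem sumProb_nonneg (ν : Measure ℕ) (N m : ℕ) : 0 ≤ sumProb ν N m := measureReal_nonneg

/-- Splitting off coordinate `j` leaves `M` independent variables, whose sum must be `m`. -/
theorem measureReal_eval_eq_inter_sumEvent (ν : Measure ℕ) [IsProbabilityMeasure ν] (M m a : ℕ)
    (j : Fin (M + 1)) :
    (Measure.pi fun _ : Fin (M + 1) => ν).real ({x | x j = a} ∩ sumEvent (M + 1) (m + a)) =
      ν.real {a} * sumProb ν M m := by
  have h := measurePreserving_piFinSuccAbove (fun _ : Fin (M + 1) => ν) j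
  have hpre : {x : Fin (M + 1) → ℕ | x j = a} ∩ sumEvent (M + 1) (m + a) =
      MeasurableEquiv.piFinSuccAbove (fun _ => ℕ) j ⁻¹' ({a} ×ˢ sumEvent M m) := by
    ext x
    simp only [sumEvent, Set.mem_inter_iff, Set.mem_ofPred_eq, Set.mem_preimage, Set.mem_prod,
      Set.mem_singleton_iff, Fin.sum_univ_succAbove _ j]
    change _ ↔ x j = a ∧ ∑ i, x (j.succAbove i) = m
    constructor
    · rintro ⟨h1, h2⟩; exact ⟨h1, by omega⟩
    · rintro ⟨h1, h2⟩; exact ⟨h1, by omega⟩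
  rw [hpre, measureReal_def, h.measure_preimage
    ((measurableSet_singleton a).prod (measurableSet_sumEvent M m)).nullMeasurableSet,
    Measure.prod_prod, ENNReal.toReal_mul]
  rfl

/-- All coordinates contribute equally. This exact identity links sums of `M + 1` and of `M`
variables. -/
theorem setIntegral_hitCount_singleton (ν : Measure ℕ) [IsProbabilityMeasure ν] (M m a : ℕ) :
    ∫ x in sumEvent (M + 1) (m + a), hitCount {a} x ∂(Measure.pi fun _ : Fin (M + 1) => ν) =
      (M + 1 : ℕ) * ν.real {a} * sumProb ν M m := by
  simp only [hitCount]
  have hms : ∀ j : Fin (M + 1), MeasurableSet {x : Fin (M + 1) → ℕ | x j = a} := fun j =>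
    (Set.to_countable _).measurableSet
  have hind : ∀ (j : Fin (M + 1)), (fun x : Fin (M + 1) → ℕ =>
      ({a} : Set ℕ).indicator (fun _ => (1 : ℝ)) (x j)) = {x | x j = a}.indicator 1 := fun j => by
    ext x; by_cases h : x j = a <;> simp [h]
  rw [integral_finsetSum]
  · have : ∀ j : Fin (M + 1), ∫ x in sumEvent (M + 1) (m + a),
        ({a} : Set ℕ).indicator (fun _ => (1 : ℝ)) (x j) ∂(Measure.pi fun _ => ν) =
        ν.real {a} * sumProb ν M m := fun j => by
      rw [hind, integral_indicator_one (hms j), measureReal_restrict_apply (hms j),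
        measureReal_eval_eq_inter_sumEvent]
    rw [Finset.sum_congr rfl fun j _ => this j]
    simp; ring
  · intro j _
    rw [hind]
    exact (integrable_const (1 : ℝ)).indicator (hms j)

/-- One step comparison of `P(S_{M+1} = m + a)` and `P(S_M = m)`. -/
theorem sumProb_step (ν : Measure ℕ) [IsProbabilityMeasure ν] {c d e : ℝ} (hc : 0 < c)
    (hd : 0 ≤ d) (M m a : ℕ) (ha : c ≤ ν.real {a})
    (he : (Measure.pi fun _ : Fin (M + 1) => ν).real
      {x | d ≤ |hitCount {a} x - (M + 1 : ℕ) * ν.real {a}|} ≤ e) :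
    sumProb ν M m ≤ (1 + d / ((M + 1 : ℕ) * c)) * sumProb ν (M + 1) (m + a) + e / c ∧
    (1 - d / ((M + 1 : ℕ) * c)) * sumProb ν (M + 1) (m + a) ≤ sumProb ν M m + e / c := by
  have hN : (0 : ℝ) < (M + 1 : ℕ) := by positivity
  set N : ℝ := ((M + 1 : ℕ) : ℝ)
  have hp1 : ν.real {a} ≤ 1 := measureReal_le_one
  set p := ν.real {a}
  have hp : 0 < p := hc.trans_le ha
  have hf := sumProb_nonneg ν (M + 1) (m + a)
  have h1 := setIntegral_le_of_concentrated (μ := Measure.pi fun _ : Fin (M + 1) => ν)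
    (measurable_hitCount (measurableSet_singleton a)) (hitCount_nonneg {a}) (hitCount_le {a})
    (c := N * p) (by positivity) hd (measurableSet_sumEvent (M + 1) (m + a))
  have h2 := le_setIntegral_of_concentrated (μ := Measure.pi fun _ : Fin (M + 1) => ν)
    (measurable_hitCount (measurableSet_singleton a)) (hitCount_nonneg {a}) (hitCount_le {a})
    (c := N * p) (mul_le_of_le_one_right hN.le hp1) hd (measurableSet_sumEvent (M + 1) (m + a))
  -- With the integral known exactly, the two concentration bounds become a two-sided comparison;
  -- dividing by `N p` finishes.
  rw [setIntegral_hitCount_singleton] at h1 h2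
  change N * p * sumProb ν M m ≤ (N * p + d) * sumProb ν (M + 1) (m + a) + _ at h1
  change (N * p - d) * sumProb ν (M + 1) (m + a) ≤ N * p * sumProb ν M m + _ at h2
  have he0 : 0 ≤ e := measureReal_nonneg.trans he
  have hNe := mul_le_mul_of_nonneg_left he hN.le
  have hde : d / (N * p) ≤ d / (N * c) := by gcongr
  have hee : e / p ≤ e / c := by gcongr
  constructor
  · have h3 : sumProb ν M m ≤ (1 + d / (N * p)) * sumProb ν (M + 1) (m + a) + e / p := by
      have : (1 + d / (N * p)) * sumProb ν (M + 1) (m + a) + e / p =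
        ((N * p + d) * sumProb ν (M + 1) (m + a) + N * e) / (N * p) := by field_simp
      rw [this, le_div_iff₀ (by positivity)]
      linarith
    nlinarith [mul_le_mul_of_nonneg_right hde hf]
  · have h3 : (1 - d / (N * p)) * sumProb ν (M + 1) (m + a) ≤ sumProb ν M m + e / p := by
      have : (1 - d / (N * p)) * sumProb ν (M + 1) (m + a) =
        ((N * p - d) * sumProb ν (M + 1) (m + a)) / (N * p) := by field_simp
      rw [this, div_le_iff₀ (by positivity)]
      have : (sumProb ν M m + e / p) * (N * p) = N * p * sumProb ν M m + N * e := by field_simp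
      linarith
    nlinarith [mul_le_mul_of_nonneg_right hde hf]

theorem le_pow_mul_of_forall_step {f : ℕ → ℝ} {r h : ℝ} (hr : 1 ≤ r) (hh : 0 ≤ h)
    (h1 : ∀ m, f m ≤ r * f (m + 1) + h) (h2 : ∀ m, f (m + 1) ≤ r * f m + h) (m d : ℕ) :
    f m ≤ r ^ d * (f (m + d) + d * h) ∧ f (m + d) ≤ r ^ d * (f m + d * h) := by
  induction d with
  | zero => simp
  | succ d ih =>
    have hrd : 1 ≤ r ^ d := one_le_pow₀ hr
    have hrd1 : 1 ≤ r ^ (d + 1) := one_le_pow₀ hr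
    constructor
    · calc f m ≤ r ^ d * (f (m + d) + d * h) := ih.1
        _ ≤ r ^ d * ((r * f (m + d + 1) + h) + d * h) := by gcongr; exact h1 _
        _ ≤ r ^ d * (r * (f (m + d + 1) + (d + 1 : ℕ) * h)) := by
          refine mul_le_mul_of_nonneg_left ?_ (by positivity)
          push_cast
          nlinarith [mul_nonneg (sub_nonneg.2 hr) (mul_nonneg (by positivity : (0:ℝ) ≤ d + 1) hh)]
        _ = _ := by rw [pow_succ]; ring_nf
    · calc f (m + (d + 1)) ≤ r * f (m + d) + h := h2 (m + d)
        _ ≤ r * (r ^ d * (f m + d * h)) + h := by gcongr; exact ih.2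
        _ ≤ r ^ (d + 1) * (f m + d * h) + r ^ (d + 1) * h := by
          rw [pow_succ']; rw [pow_succ'] at hrd1; nlinarith
        _ = _ := by push_cast; ring

/-- Neighbouring values of `P(S_N = ·)` are comparable. -/
theorem sumProb_neighbours (ν : Measure ℕ) [IsProbabilityMeasure ν] {c d e : ℝ} (hc : 0 < c)
    (hd : 0 ≤ d) (M : ℕ) (ha : ∀ a ∈ ({0, 1} : Set ℕ), c ≤ ν.real {a})
    (hx : d / ((M + 1 : ℕ) * c) ≤ 1 / 2)
    (he : ∀ a ∈ ({0, 1} : Set ℕ), (Measure.pi fun _ : Fin (M + 1) => ν).real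
      {x | d ≤ |hitCount {a} x - (M + 1 : ℕ) * ν.real {a}|} ≤ e) (m : ℕ) :
    sumProb ν (M + 1) m ≤
        (1 + 4 * (d / ((M + 1 : ℕ) * c))) * sumProb ν (M + 1) (m + 1) + 4 * (e / c) ∧
    sumProb ν (M + 1) (m + 1) ≤
        (1 + 4 * (d / ((M + 1 : ℕ) * c))) * sumProb ν (M + 1) m + 4 * (e / c) := by
  -- Both neighbours are compared with the same intermediate quantity `sumProb ν M m`.
  have s0 := sumProb_step ν hc hd M m 0 (ha 0 (by simp)) (he 0 (by simp))
  have s1 := sumProb_step ν hc hd M m 1 (ha 1 (by simp)) (he 1 (by simp))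
  rw [add_zero] at s0
  have he0 : 0 ≤ e / c := div_nonneg (measureReal_nonneg.trans (he 0 (by simp))) hc.le
  have hx0 : 0 ≤ d / ((M + 1 : ℕ) * c) := by positivity
  have hf0 := sumProb_nonneg ν (M + 1) m
  have hf1 := sumProb_nonneg ν (M + 1) (m + 1)
  generalize d / ((M + 1 : ℕ) * c) = x at *
  -- For `0 ≤ x ≤ 1/2` one has `1 + x ≤ (1 - x)(1 + 4x)` and `1/(1 - x) ≤ 2`.
  have key : ∀ u v : ℝ, 0 ≤ v → (1 - x) * u ≤ (1 + x) * v + 2 * (e / c) →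
      u ≤ (1 + 4 * x) * v + 4 * (e / c) := fun u v hv h => by
    have h1 : (1 + x) * v ≤ (1 - x) * ((1 + 4 * x) * v) := by
      nlinarith [mul_nonneg (mul_nonneg hx0 (by linarith : 0 ≤ 1 - 2 * x)) hv]
    have h2 : 2 * (e / c) ≤ (1 - x) * (4 * (e / c)) := by nlinarith
    have h3 : (1 - x) * u ≤ (1 - x) * ((1 + 4 * x) * v + 4 * (e / c)) := by
      rw [mul_add]; linarith
    exact le_of_mul_le_mul_left h3 (by linarith)
  exact ⟨key _ _ hf1 (by linarith [s0.2, s1.1]), key _ _ hf0 (by linarith [s0.1, s1.2])⟩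

/-- Chebyshev's inequality for the sum: most of its mass is near the mean. -/
theorem half_le_sum_sumProb (ν : Measure ℕ) [IsProbabilityMeasure ν] {V : ℝ} (N n L : ℕ)
    (hL2 : MemLp (fun k : ℕ => (k : ℝ)) 2 ν) (hV : ∫ k, (k : ℝ) ^ 2 ∂ν ≤ V)
    (hn : (n : ℝ) = N * ∫ k, (k : ℝ) ∂ν) (hL : 0 < L) (hLV : 2 * V * N ≤ (L : ℝ) ^ 2) :
    1 / 2 ≤ ∑ m ∈ Finset.Icc (n - L) (n + L), sumProb ν N m := by
  set μ := Measure.pi fun _ : Fin N => ν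
  set S : (Fin N → ℕ) → ℝ := ∑ j, fun x => (x j : ℝ) with hS
  have hSx : ∀ x, S x = ((∑ j, x j : ℕ) : ℝ) := fun x => by simp [hS]
  have hmem : ∀ j : Fin N, MemLp (fun x : Fin N → ℕ => (x j : ℝ)) 2 μ := fun j =>
    hL2.comp_measurePreserving (measurePreserving_eval (fun _ : Fin N => ν) j)
  have hSm : MemLp S 2 μ := memLp_finsetSum' _ fun j _ => hmem j
  have hvar : Var[S; μ] ≤ N * V := by
    have := variance_sum_pi (μ := fun _ : Fin N => ν) (X := fun _ k => (k : ℝ)) fun _ => hL2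
    rw [hS, this]
    have h2 : Var[fun k : ℕ => (k : ℝ); ν] ≤ V :=
      (variance_le_expectation_sq (by fun_prop)).trans (by simpa using hV)
    simpa using mul_le_mul_of_nonneg_left h2 (Nat.cast_nonneg N)
  have hmean : ∫ x, S x ∂μ = n := by
    rw [hn, hS]
    simp only [Finset.sum_apply]
    rw [integral_finsetSum _ fun j _ => (hmem j).integrable (by norm_num)]
    have : ∀ j : Fin N, ∫ x, (x j : ℝ) ∂μ = ∫ k, (k : ℝ) ∂ν := fun j => by
      have hp := measurePreserving_eval (fun _ : Fin N => ν) j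
      have h4 := integral_map (μ := μ) hp.measurable.aemeasurable
        (f := fun k : ℕ => (k : ℝ)) (by fun_prop)
      rw [hp.map_eq] at h4
      exact h4.symm
    simp [this]
  have hLpos : (0 : ℝ) < L := by exact_mod_cast hL
  have hch := meas_ge_le_variance_div_sq hSm hLpos
  rw [hmean] at hch
  have hch2 : μ.real {x | (L : ℝ) ≤ |S x - n|} ≤ 1 / 2 := by
    refine ENNReal.toReal_le_of_le_ofReal (by norm_num) (hch.trans (ENNReal.ofReal_le_ofReal ?_))
    rw [div_le_iff₀ (by positivity)]
    linarith
  have hcover : {x | (L : ℝ) ≤ |S x - n|}ᶜ ⊆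
      ⋃ m ∈ Finset.Icc (n - L) (n + L), sumEvent N m := fun x hx => by
    simp only [Set.mem_compl_iff, Set.mem_ofPred_eq, not_le, hSx, abs_lt] at hx
    simp only [Set.mem_iUnion, sumEvent, Set.mem_ofPred_eq, exists_prop, Finset.mem_Icc]
    refine ⟨_, ⟨?_, ?_⟩, rfl⟩
    · have : (n : ℝ) < (∑ j, x j : ℕ) + L := by linarith [hx.1]
      have : n < (∑ j, x j) + L := by exact_mod_cast this
      omega
    · have : ((∑ j, x j : ℕ) : ℝ) < n + L := by linarith [hx.2]
      have : (∑ j, x j) < n + L := by exact_mod_cast this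
      omega
  have h1 := (measureReal_mono (μ := μ) hcover (measure_ne_top _ _)).trans
    (measureReal_biUnion_finset_le _ _)
  rw [probReal_compl_eq_one_sub₀ ((Set.to_countable _).measurableSet.nullMeasurableSet)] at h1
  change _ ≤ ∑ m ∈ _, sumProb ν N m at h1
  linarith

/-- Neighbouring values differ by a factor `1 + O(√(log N / N))`, so over `O(√N)` steps the factor
is `exp(O(√(log N))) ≤ N^{1/4}`. If the value at `n` were below `1/N`, the mass of the Chebyshev
window would be `O(√N · N^{1/4} · 1/N)`, which tends to zero, yet it is at least `1/2`. The
threshold depends only on `c` and `V`, since `ν` will vary with `n`. -/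
theorem exists_forall_inv_le_sumProb {c V : ℝ} (hc : 0 < c) (hV1 : 1 ≤ V) :
    ∃ N₀ : ℕ, ∀ N ≥ N₀, ∀ ν : Measure ℕ, IsProbabilityMeasure ν →
      (∀ a ∈ ({0, 1} : Set ℕ), c ≤ ν.real {a}) → MemLp (fun k : ℕ => (k : ℝ)) 2 ν →
      ∫ k, (k : ℝ) ^ 2 ∂ν ≤ V → ∀ n : ℕ, (n : ℝ) = N * ∫ k, (k : ℝ) ∂ν →
      1 / (N : ℝ) ≤ sumProb ν N n := by
  set A : ℝ := 3 * √(2 * V) with hA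
  have hA0 : 0 < A := by positivity
  have hlogN : Tendsto (fun N : ℕ => Real.log N) atTop atTop :=
    Real.tendsto_log_atTop.comp tendsto_natCast_atTop_atTop
  have hsq : Tendsto (fun N : ℕ => √(Real.log N / N)) atTop (nhds 0) := by
    have h1 : Tendsto (fun N : ℕ => Real.log N / N) atTop (nhds 0) :=
      (Real.isLittleO_log_id_atTop.tendsto_div_nhds_zero).comp tendsto_natCast_atTop_atTop
    simpa using h1.sqrt
  -- The three thresholds serve, in order, the condition `x ≤ 1/2` of the neighbour comparison, the
  -- bound `r ^ L ≤ N^{1/4}`, and the final contradiction.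
  have ev1 : ∀ᶠ N : ℕ in atTop, √(Real.log N / N) ≤ c / 8 :=
    (hsq.eventually (gt_mem_nhds (by positivity : 0 < c / 8))).mono fun _ h => le_of_lt h
  have ev2 : ∀ᶠ N : ℕ in atTop, 64 * A / c ≤ √(Real.log N) :=
    (Real.tendsto_sqrt_atTop.comp hlogN).eventually_ge_atTop _
  have ev3 : ∀ᶠ N : ℕ in atTop, 6 * A * (1 + 8 * A / c) < √(√(N : ℝ)) :=
    (Real.tendsto_sqrt_atTop.comp (Real.tendsto_sqrt_atTop.comp
      tendsto_natCast_atTop_atTop)).eventually_gt_atTop _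
  obtain ⟨N₀, hN₀⟩ := eventually_atTop.1 ((ev1.and ev2).and (ev3.and (eventually_ge_atTop 1)))
  refine ⟨N₀, fun N hN ν _ ha hL2 hV n hn => ?_⟩
  obtain ⟨⟨h1, h2⟩, h3, hN1⟩ := hN₀ N hN
  obtain ⟨M, rfl⟩ : ∃ M, N = M + 1 := ⟨N - 1, by omega⟩
  have hNr : (1 : ℝ) ≤ (M + 1 : ℕ) := by exact_mod_cast hN1
  generalize hNN : ((M + 1 : ℕ) : ℝ) = R at *
  have hR0 : 0 < R := by linarith
  have hlog0 : 0 ≤ Real.log R := Real.log_nonneg hNr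
  set l := √(Real.log R / R) with hl
  have hl2 : l ^ 2 = Real.log R / R := Real.sq_sqrt (by positivity)
  have hl0 : 0 ≤ l := Real.sqrt_nonneg _
  have hl1 : l ≤ 1 := Real.sqrt_le_one.2 ((div_le_one hR0).2 (Real.log_le_self hR0.le))
  have hRl2 : R * l ^ 2 = Real.log R := by rw [hl2]; field_simp
  -- Since `R l² = log R`, the deviation `4 R l` contributes `-4 log R` to the exponent and the
  -- variance term at most `log R`, leaving `R⁻³`.
  have hconc : ∀ a ∈ ({0, 1} : Set ℕ), (Measure.pi fun _ : Fin (M + 1) => ν).real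
      {x | 4 * R * l ≤ |hitCount {a} x - (M + 1 : ℕ) * ν.real {a}|} ≤ 2 / R ^ 3 := by
    intro a _
    refine (measureReal_abs_hitCount_sub_ge_le ν (measurableSet_singleton a) hl0 hl1 (M + 1)
      (4 * R * l)).trans ?_
    rw [hNN]
    have hp : ν.real {a} * (1 - ν.real {a}) ≤ 1 := by
      nlinarith [measureReal_nonneg (μ := ν) (s := {a}), measureReal_le_one (μ := ν) (s := {a})]
    have hp0 : 0 ≤ ν.real {a} * (1 - ν.real {a}) :=
      mul_nonneg measureReal_nonneg (sub_nonneg.2 measureReal_le_one)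
    have : 2 / R ^ 3 = 2 * Real.exp (-(3 * Real.log R)) := by
      rw [Real.exp_neg, mul_comm 3, Real.exp_mul, Real.exp_log hR0]
      norm_cast
    rw [this]
    gcongr
    have : ν.real {a} * (1 - ν.real {a}) * ((1 + l) / 2) ≤ 1 := by nlinarith
    nlinarith [mul_le_mul_of_nonneg_left this (by positivity : 0 ≤ R * l ^ 2)]
  have hdx : 4 * R * l / (R * c) = 4 * l / c := by field_simp
  have hx : 4 * R * l / (R * c) ≤ 1 / 2 := by
    rw [hdx, div_le_iff₀ hc]; linarith
  have hstep := sumProb_neighbours ν hc (by positivity : 0 ≤ 4 * R * l) M ha (by rw [hNN]; exact hx)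
    hconc
  rw [hNN, hdx] at hstep
  -- The half-width at which Chebyshev's inequality leaves mass at least `1/2`; it is at most `A
  -- √R`.
  set L : ℕ := ⌈√(2 * V * R)⌉₊ + 1 with hLdef
  have hsV : 1 ≤ √(2 * V * R) := Real.one_le_sqrt.2 (by nlinarith)
  have hLle : (L : ℝ) ≤ A * √R := by
    have := (Nat.ceil_lt_add_one (Real.sqrt_nonneg (2 * V * R))).le
    have h5 : A * √R = 3 * √(2 * V * R) := by rw [hA, Real.sqrt_mul (by positivity : 0 ≤ 2 * V)]; ring
    rw [h5, hLdef]; push_cast; linarith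
  have hLge : √(2 * V * R) ≤ L := by
    have := Nat.le_ceil (√(2 * V * R)); rw [hLdef]; push_cast; linarith
  have hhalf := half_le_sum_sumProb ν (M + 1) n L hL2 hV (by rw [hNN]; exact hn)
    (by omega) (by
      rw [hNN]
      calc 2 * V * R = √(2 * V * R) ^ 2 := (Real.sq_sqrt (by positivity)).symm
        _ ≤ (L : ℝ) ^ 2 := by gcongr)
  by_contra hlt
  rw [not_le] at hlt
  set f := sumProb ν (M + 1)
  set r := 1 + 4 * (4 * l / c) with hr
  set h := 4 * (2 / R ^ 3 / c) with hh
  have hr1 : 1 ≤ r := by rw [hr]; linarith [(by positivity : 0 ≤ 4 * (4 * l / c))]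
  have hh0 : 0 ≤ h := by positivity
  have hfn : 0 ≤ f n := sumProb_nonneg _ _ _
  have hbound : ∀ m ∈ Finset.Icc (n - L) (n + L), f m ≤ r ^ L * (f n + L * h) := by
    intro m hm
    rw [Finset.mem_Icc] at hm
    have aux : ∀ d : ℕ, d ≤ L → r ^ d * (f n + d * h) ≤ r ^ L * (f n + L * h) := fun d hd => by
      have : (d : ℝ) ≤ L := by exact_mod_cast hd
      gcongr
    rcases le_total m n with hmn | hmn
    · obtain ⟨d, rfl⟩ := Nat.exists_eq_add_of_le hmn
      exact (le_pow_mul_of_forall_step hr1 hh0 (fun m => (hstep m).1) (fun m => (hstep m).2)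
        m d).1.trans (aux d (by omega))
    · obtain ⟨d, rfl⟩ := Nat.exists_eq_add_of_le hmn
      exact (le_pow_mul_of_forall_step hr1 hh0 (fun m => (hstep m).1) (fun m => (hstep m).2)
        n d).2.trans (aux d (by omega))
  have hsum := Finset.sum_le_card_nsmul _ _ _ hbound
  have hcard : ((Finset.Icc (n - L) (n + L)).card : ℝ) ≤ 3 * L := by
    rw [Nat.card_Icc]
    have : n + L + 1 - (n - L) ≤ 3 * L := by omega
    exact_mod_cast this
  rw [nsmul_eq_mul] at hsum
  -- `u = R^{1/4}`, the allowance for the accumulated ratio `r ^ L`.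
  set u := √√R with hu
  have hu2 : u ^ 2 = √R := Real.sq_sqrt (Real.sqrt_nonneg _)
  have hu4 : u ^ 4 = R := by
    rw [show u ^ 4 = (u ^ 2) ^ 2 by ring, hu2, Real.sq_sqrt hR0.le]
  have hu1 : 1 ≤ u := Real.one_le_sqrt.2 (Real.one_le_sqrt.2 hNr)
  have hu0 : 0 < u := by linarith
  have hrL : r ^ L ≤ u := by
    have e1 : r ^ L ≤ Real.exp (L * (4 * (4 * l / c))) := by
      rw [Real.exp_nat_mul]
      gcongr
      rw [hr]; linarith [Real.add_one_le_exp (4 * (4 * l / c))]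
    have e2 : u = Real.exp (Real.log R / 4) := by
      have : Real.log R = 4 * Real.log u := by rw [← hu4, Real.log_pow]; norm_num
      rw [this, mul_div_cancel_left₀ _ (by norm_num), Real.exp_log hu0]
    rw [e2]
    refine e1.trans (Real.exp_le_exp.2 ?_)
    have e3 : √R * l = √(Real.log R) := by
      rw [hl, ← Real.sqrt_mul hR0.le]; congr 1; field_simp
    have e4 : √(Real.log R) ^ 2 = Real.log R := Real.sq_sqrt hlog0
    calc L * (4 * (4 * l / c)) ≤ (A * √R) * (4 * (4 * l / c)) := by gcongr
      _ = (64 * A / c) * (√R * l) / 4 := by ring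
      _ ≤ √(Real.log R) * √(Real.log R) / 4 := by rw [e3]; gcongr
      _ = Real.log R / 4 := by rw [← sq, e4]
  have hfin : f n + L * h ≤ (1 + 8 * A / c) / R := by
    have : (L : ℝ) * h ≤ (8 * A / c) / R := by
      calc (L : ℝ) * h ≤ (A * √R) * h := by gcongr
        _ = (8 * A / c) / R * (√R / R ^ 2) := by rw [hh]; field_simp; ring
        _ ≤ (8 * A / c) / R * 1 := by
          gcongr
          rw [div_le_one (by positivity)]
          rw [← hu2, ← hu4, ← pow_mul]
          exact pow_le_pow_right₀ hu1 (by norm_num)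
        _ = _ := mul_one _
    rw [add_div]; linarith
  have : (1 : ℝ) / 2 ≤ 3 * A * (1 + 8 * A / c) / u := by
    calc (1 : ℝ) / 2 ≤ (3 * L) * (r ^ L * (f n + L * h)) :=
          hhalf.trans (hsum.trans (by gcongr))
      _ ≤ (3 * (A * √R)) * (u * ((1 + 8 * A / c) / R)) := by gcongr
      _ = 3 * A * (1 + 8 * A / c) / u := by
        rw [← hu2, ← hu4]; field_simp
  rw [le_div_iff₀ hu0] at this
  linarith

/-! ### Power series and their distributions -/

/-- For `ρ` strictly between `r` and the radius, the terms at `ρ` are bounded, so the series is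
dominated by a multiple of `∑ k^p (r/ρ)^k`. -/
theorem summable_pow_mul_term {b : ℕ → ℝ} {r : ℝ} (hr0 : 0 ≤ r)
    (hr : ENNReal.ofReal r < radius b) (p : ℕ) :
    Summable fun k : ℕ => (k : ℝ) ^ p * (b k * r ^ k / (k ! : ℝ)) := by
  obtain ⟨ρ, h1, h2⟩ := ENNReal.lt_iff_exists_nnreal_btwn.1 hr
  obtain ⟨C, hC, h3⟩ := FormalMultilinearSeries.norm_mul_pow_le_of_lt_radius _ h2
  have hρ : r < ρ := by
    rw [ENNReal.ofReal, ENNReal.coe_lt_coe] at h1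
    exact (Real.toNNReal_lt_iff_lt_coe hr0).1 h1
  have hρ0 : (0 : ℝ) < ρ := hr0.trans_lt hρ
  have hq : ‖r / ρ‖ < 1 := by
    rw [Real.norm_eq_abs, abs_of_nonneg (by positivity), div_lt_one hρ0]; exact hρ
  refine Summable.of_norm_bounded
    ((summable_pow_mul_geometric_of_norm_lt_one p hq).mul_left C) fun k => ?_
  have h4 := h3 k
  rw [FormalMultilinearSeries.ofScalars_norm, Real.norm_eq_abs] at h4
  have : ‖(k : ℝ) ^ p * (b k * r ^ k / (k ! : ℝ))‖ =
      (k : ℝ) ^ p * (|b k / (k ! : ℝ)| * (ρ : ℝ) ^ k * (r / ρ) ^ k) := by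
    rw [div_pow, mul_assoc |b k / _|, mul_div_cancel₀ _ (by positivity), Real.norm_eq_abs,
      abs_mul, abs_of_nonneg (by positivity : (0 : ℝ) ≤ (k : ℝ) ^ p), mul_div_right_comm, abs_mul,
      abs_of_nonneg (by positivity : (0 : ℝ) ≤ r ^ k)]
  rw [this]
  calc (k : ℝ) ^ p * (|b k / (k ! : ℝ)| * (ρ : ℝ) ^ k * (r / ρ) ^ k)
      ≤ (k : ℝ) ^ p * (C * (r / ρ) ^ k) := by gcongr
    _ = _ := by ring

theorem summable_term {b : ℕ → ℝ} {θ : ℝ} (hθ : θ ∈ paramSet b) :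
    Summable fun k : ℕ => b k * θ ^ k / (k ! : ℝ) := by
  simpa using summable_pow_mul_term hθ.1.le hθ.2 0

section Law

variable {b : ℕ → ℝ} {θ : ℝ}

theorem term_nonneg (hb : ∀ k, 0 ≤ b k) (hθ : 0 ≤ θ) (k : ℕ) :
    0 ≤ b k * θ ^ k / (k ! : ℝ) := by
  have := hb k
  positivity

theorem le_seriesB (hb : ∀ k, 0 ≤ b k) (hθ : 0 ≤ θ)
    (hs : Summable fun k : ℕ => b k * θ ^ k / (k ! : ℝ)) : b 0 ≤ seriesB b θ := by
  simpa [seriesB] using hs.le_tsum 0 fun k _ => term_nonneg hb hθ k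

theorem weight_eq (b : ℕ → ℝ) (θ : ℝ) (k : ℕ) :
    weight b θ k = b k * θ ^ k / (k ! : ℝ) / seriesB b θ := by
  rw [weight, div_div]

theorem weight_nonneg (hb : ∀ k, 0 ≤ b k) (hθ : 0 ≤ θ) (k : ℕ) : 0 ≤ weight b θ k := by
  rw [weight_eq]
  exact div_nonneg (term_nonneg hb hθ k) (tsum_nonneg fun k => term_nonneg hb hθ k)

theorem law_singleton (b : ℕ → ℝ) (θ : ℝ) (k : ℕ) :
    law b θ {k} = ENNReal.ofReal (weight b θ k) := by
  rw [law, Measure.sum_apply _ (measurableSet_singleton k), tsum_eq_single k]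
  · simp
  · intro j hj
    simp [hj]

theorem measureReal_law_singleton (hb : ∀ k, 0 ≤ b k) (hθ : 0 ≤ θ) (k : ℕ) :
    (law b θ).real {k} = weight b θ k := by
  rw [measureReal_def, law_singleton, ENNReal.toReal_ofReal (weight_nonneg hb hθ k)]

theorem hasSum_weight (hb : ∀ k, 0 ≤ b k) (hb0 : 0 < b 0) (hθ : 0 ≤ θ)
    (hs : Summable fun k : ℕ => b k * θ ^ k / (k ! : ℝ)) : HasSum (weight b θ) 1 := by
  have h := hs.hasSum.div_const (seriesB b θ)
  have h1 : (∑' k : ℕ, b k * θ ^ k / (k ! : ℝ)) / seriesB b θ = 1 :=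
    div_self (hb0.trans_le (le_seriesB hb hθ hs)).ne'
  rw [h1] at h
  exact (funext (weight_eq b θ)) ▸ h

theorem isProbabilityMeasure_law (hb : ∀ k, 0 ≤ b k) (hb0 : 0 < b 0) (hθ : 0 ≤ θ)
    (hs : Summable fun k : ℕ => b k * θ ^ k / (k ! : ℝ)) : IsProbabilityMeasure (law b θ) := by
  have h := hasSum_weight hb hb0 hθ hs
  constructor
  rw [law, Measure.sum_apply _ MeasurableSet.univ]
  simp only [Measure.smul_apply, measure_univ, smul_eq_mul, mul_one]
  rw [← ENNReal.ofReal_tsum_of_nonneg (weight_nonneg hb hθ) h.summable, h.tsum_eq]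
  simp

theorem integrable_law (hb : ∀ k, 0 ≤ b k) (hθ : 0 ≤ θ) {f : ℕ → ℝ} (hf : ∀ k, 0 ≤ f k)
    (hs : Summable fun k => f k * (b k * θ ^ k / (k ! : ℝ))) : Integrable f (law b θ) := by
  refine ⟨(measurable_of_countable f).aestronglyMeasurable, ?_⟩
  rw [hasFiniteIntegral_iff_norm, lintegral_countable']
  have h : Summable fun k => f k * weight b θ k := by
    refine (hs.div_const (seriesB b θ)).congr fun k => ?_
    rw [weight_eq, mul_div_assoc]
  have h2 : ∀ k, ENNReal.ofReal ‖f k‖ * law b θ {k} = ENNReal.ofReal (f k * weight b θ k) :=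
    fun k => by
      rw [law_singleton, Real.norm_eq_abs, abs_of_nonneg (hf k), ENNReal.ofReal_mul (hf k)]
  simp_rw [h2]
  rw [← ENNReal.ofReal_tsum_of_nonneg (fun k => mul_nonneg (hf k) (weight_nonneg hb hθ k)) h]
  exact ENNReal.ofReal_lt_top

theorem integral_law (hb : ∀ k, 0 ≤ b k) (hθ : 0 ≤ θ) {f : ℕ → ℝ} (hf : ∀ k, 0 ≤ f k)
    (hs : Summable fun k => f k * (b k * θ ^ k / (k ! : ℝ))) :
    ∫ k, f k ∂(law b θ) = (∑' k, f k * (b k * θ ^ k / (k ! : ℝ))) / seriesB b θ := by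
  rw [integral_countable (integrable_law hb hθ hf hs), ← tsum_div_const]
  refine tsum_congr fun k => ?_
  rw [measureReal_law_singleton hb hθ, weight_eq, smul_eq_mul]
  ring

end Law

/-! ### The mean, its inverse, and bounds on compact parameter intervals -/

section Mean

variable {b : ℕ → ℝ}

theorem mean_eq (hb : ∀ k, 0 ≤ b k) {θ : ℝ} (hθ : θ ∈ paramSet b) :
    mean b θ = (∑' k : ℕ, (k : ℝ) * (b k * θ ^ k / (k ! : ℝ))) / seriesB b θ :=
  integral_law hb hθ.1.le (fun k => by positivity)
    (by simpa using summable_pow_mul_term hθ.1.le hθ.2 1)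

theorem mem_paramSet_of_le {θ T : ℝ} (hT : T ∈ paramSet b) (h0 : 0 < θ) (h : θ ≤ T) :
    θ ∈ paramSet b :=
  ⟨h0, (ENNReal.ofReal_le_ofReal h).trans_lt hT.2⟩

/-- A tilting argument without derivatives: passing from `θ` to `u` multiplies the `k`-th term by
`(u/θ)^k`, which favours the terms with `k` above the mean `c`. -/
theorem mean_le_mean (hb : ∀ k, 0 ≤ b k) (hb0 : 0 < b 0) {θ u : ℝ} (hθ : θ ∈ paramSet b)
    (hu : u ∈ paramSet b) (h : θ ≤ u) : mean b θ ≤ mean b u := by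
  have hsum : ∀ {t : ℝ}, t ∈ paramSet b → ∀ c : ℝ,
      HasSum (fun k : ℕ => ((k : ℝ) - c) * (b k * t ^ k / (k ! : ℝ)))
        ((mean b t - c) * seriesB b t) := fun {t} ht c => by
    have h1 : Summable fun k : ℕ => (k : ℝ) * (b k * t ^ k / (k ! : ℝ)) := by
      simpa using summable_pow_mul_term ht.1.le ht.2 1
    have hB : seriesB b t ≠ 0 := (hb0.trans_le (le_seriesB hb ht.1.le (summable_term ht))).ne'
    have h2 := h1.hasSum.sub ((summable_term ht).hasSum.mul_left c)
    rw [mean_eq hb ht, sub_mul, div_mul_cancel₀ _ hB]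
    simpa only [sub_mul, seriesB] using h2
  set c := mean b θ
  have h0 := hsum hθ c
  have h1 := hsum hu c
  have hρ : 1 ≤ u / θ := (one_le_div hθ.1).2 h
  have hρ0 : 0 < u / θ := by linarith
  -- Termwise, `(u/θ)^c (k - c) ≤ (u/θ)^k (k - c)` whatever the sign of `k - c`; the left side sums
  -- to zero.
  have h2 : (u / θ) ^ c * ((c - c) * seriesB b θ) ≤ (mean b u - c) * seriesB b u := by
    refine hasSum_le (fun k => ?_) (h0.mul_left ((u / θ) ^ c)) h1
    have e1 : b k * u ^ k / (k ! : ℝ) = (u / θ) ^ (k : ℝ) * (b k * θ ^ k / (k ! : ℝ)) := by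
      have := hθ.1.ne'
      rw [Real.rpow_natCast, div_pow]; field_simp
    have e2 : (u / θ) ^ c * ((k : ℝ) - c) ≤ (u / θ) ^ (k : ℝ) * ((k : ℝ) - c) := by
      rcases le_total c k with hk | hk
      · exact mul_le_mul_of_nonneg_right (Real.rpow_le_rpow_of_exponent_le hρ hk) (by linarith)
      · exact mul_le_mul_of_nonpos_right (Real.rpow_le_rpow_of_exponent_le hρ hk) (by linarith)
    rw [e1]
    nlinarith [mul_le_mul_of_nonneg_right e2 (term_nonneg hb hθ.1.le k)]
  rw [sub_self, zero_mul, mul_zero] at h2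
  have hB : 0 < seriesB b u := hb0.trans_le (le_seriesB hb hu.1.le (summable_term hu))
  linarith [nonneg_of_mul_nonneg_left h2 hB]

theorem continuousOn_tsum_pow_mul_term (hb : ∀ k, 0 ≤ b k) {T : ℝ} (hT : T ∈ paramSet b) (p : ℕ) :
    ContinuousOn (fun θ : ℝ => ∑' k : ℕ, (k : ℝ) ^ p * (b k * θ ^ k / (k ! : ℝ)))
      (Set.Icc 0 T) := by
  refine continuousOn_tsum (fun k => by fun_prop) (summable_pow_mul_term hT.1.le hT.2 p)
    fun k x hx => ?_
  have := hb k
  have hx0 := hx.1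
  rw [Real.norm_eq_abs, abs_of_nonneg (by positivity)]
  gcongr
  exact hx.2

theorem continuousOn_mean (hb : ∀ k, 0 ≤ b k) (hb0 : 0 < b 0) {T : ℝ} (hT : T ∈ paramSet b) :
    ContinuousOn (mean b) (Set.Ioc 0 T) := by
  have h0 := (continuousOn_tsum_pow_mul_term hb hT 0).mono Set.Ioc_subset_Icc_self
  have h1 := (continuousOn_tsum_pow_mul_term hb hT 1).mono Set.Ioc_subset_Icc_self
  refine (h1.div h0 fun x hx => ?_).congr fun x hx => ?_
  · have hx' := mem_paramSet_of_le hT hx.1 hx.2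
    simpa [seriesB] using (hb0.trans_le (le_seriesB hb hx.1.le (summable_term hx'))).ne'
  · rw [mean_eq hb (mem_paramSet_of_le hT hx.1 hx.2)]
    simp [seriesB]

/-- Near `0` the mean grows at most linearly. -/
theorem exists_mean_le_mul (hb : ∀ k, 0 ≤ b k) (hb0 : 0 < b 0) {T : ℝ} (hT : T ∈ paramSet b) :
    ∃ D > 0, ∀ θ, 0 < θ → θ ≤ T → mean b θ ≤ θ * D := by
  have hT0 := hT.1
  set Q := ∑' k : ℕ, (k : ℝ) * (b k * T ^ k / (k ! : ℝ)) with hQ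
  have hs : ∀ {t : ℝ}, t ∈ paramSet b →
      Summable fun k : ℕ => (k : ℝ) * (b k * t ^ k / (k ! : ℝ)) := fun ht => by
    simpa using summable_pow_mul_term ht.1.le ht.2 1
  have hQ0 : 0 ≤ Q := tsum_nonneg fun k => mul_nonneg (by positivity) (term_nonneg hb hT0.le k)
  refine ⟨Q / (T * b 0) + 1, by positivity, fun θ h0 hle => ?_⟩
  have hθ := mem_paramSet_of_le hT h0 hle
  have h1 : ∑' k : ℕ, (k : ℝ) * (b k * θ ^ k / (k ! : ℝ)) ≤ θ / T * Q := by
    rw [hQ, ← tsum_mul_left]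
    refine (hs hθ).tsum_le_tsum (fun k => ?_) ((hs hT).mul_left _)
    cases k with
    | zero => simp
    | succ k =>
      have := hb (k + 1)
      -- The term `k = 0` of the mean vanishes, so a factor `θ / T` can be extracted from every
      -- other term.
      have e : θ ^ (k + 1) ≤ θ / T * T ^ (k + 1) := by
        rw [pow_succ, pow_succ, mul_comm (T ^ k), ← mul_assoc, div_mul_cancel₀ _ hT0.ne',
          mul_comm θ]
        gcongr
      calc ((k + 1 : ℕ) : ℝ) * (b (k + 1) * θ ^ (k + 1) / ((k + 1)! : ℝ))
          ≤ ((k + 1 : ℕ) : ℝ) * (b (k + 1) * (θ / T * T ^ (k + 1)) / ((k + 1)! : ℝ)) := by gcongr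
        _ = _ := by ring
  rw [mean_eq hb hθ]
  calc _ ≤ (θ / T * Q) / b 0 := by
        gcongr
        exact le_seriesB hb h0.le (summable_term hθ)
    _ = θ * (Q / (T * b 0)) := by field_simp
    _ ≤ _ := by nlinarith

/-- On a compact interval of means, `meanInv` inverts `mean` and stays in a compact subinterval
of the parameter set. -/
theorem exists_meanInv_mem_Icc (hb : ∀ k, 0 ≤ b k) (hb0 : 0 < b 0) {T : ℝ} (hT : T ∈ paramSet b)
    {β : ℝ} (hβ : 0 < β) :
    ∃ τ > 0, ∀ α, β < α → α < mean b T →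
      meanInv b α ∈ Set.Icc τ T ∧ mean b (meanInv b α) = α := by
  obtain ⟨D, hD, hmD⟩ := exists_mean_le_mul hb hb0 hT
  refine ⟨β / D, by positivity, fun α h1 h2 => ?_⟩
  have hα : 0 < α := hβ.trans h1
  -- A left endpoint with `mean b t ≤ α`, by the linear bound, for the intermediate value theorem.
  set t := min T (α / D)
  have ht0 : 0 < t := lt_min hT.1 (by positivity)
  have htT : t ≤ T := min_le_left _ _
  have hmt : mean b t ≤ α := by
    refine (hmD t ht0 htT).trans ?_
    rw [← le_div_iff₀ hD]
    exact min_le_right _ _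
  have hiv := intermediate_value_Icc htT
    ((continuousOn_mean hb hb0 hT).mono fun x hx => ⟨ht0.trans_le hx.1, hx.2⟩)
  obtain ⟨x, hx, hxα⟩ := hiv ⟨hmt, h2.le⟩
  have hex : ∃ a ∈ paramSet b, mean b a = α :=
    ⟨x, mem_paramSet_of_le hT (ht0.trans_le hx.1) hx.2, hxα⟩
  have hmem : meanInv b α ∈ paramSet b := Function.invFunOn_mem hex
  have heq : mean b (meanInv b α) = α := Function.invFunOn_eq hex
  have hle : meanInv b α ≤ T := by
    by_contra hlt
    have := mean_le_mean hb hb0 hT hmem (not_le.1 hlt).le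
    linarith
  refine ⟨⟨?_, hle⟩, heq⟩
  rw [div_le_iff₀ hD]
  linarith [hmD _ hmem.1 hle]

/-- The numerator is smallest at `τ` and the normalising series largest at `T`. -/
theorem exists_pos_le_weight (hb : ∀ k, 0 ≤ b k) (hb0 : 0 < b 0) {τ T : ℝ} (hT : T ∈ paramSet b)
    (hτ : 0 < τ) {k : ℕ} (hk : 0 < b k) :
    ∃ c > 0, ∀ θ ∈ Set.Icc τ T, c ≤ weight b θ k := by
  have hBT : 0 < seriesB b T := hb0.trans_le (le_seriesB hb hT.1.le (summable_term hT))
  refine ⟨b k * τ ^ k / (k ! : ℝ) / seriesB b T, by positivity, fun θ hθ => ?_⟩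
  have h0 : 0 < θ := hτ.trans_le hθ.1
  have hp := mem_paramSet_of_le hT h0 hθ.2
  have hB : 0 < seriesB b θ := hb0.trans_le (le_seriesB hb h0.le (summable_term hp))
  have hBB : seriesB b θ ≤ seriesB b T := by
    refine (summable_term hp).tsum_le_tsum (fun j => ?_) (summable_term hT)
    have := hb j
    gcongr
    exact hθ.2
  rw [weight_eq]
  gcongr
  exact hθ.1

theorem exists_integral_sq_le (hb : ∀ k, 0 ≤ b k) (hb0 : 0 < b 0) {T : ℝ} (hT : T ∈ paramSet b) :
    ∃ V, ∀ θ, 0 < θ → θ ≤ T → MemLp (fun k : ℕ => (k : ℝ)) 2 (law b θ) ∧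
      ∫ k, (k : ℝ) ^ 2 ∂(law b θ) ≤ V := by
  refine ⟨(∑' k : ℕ, (k : ℝ) ^ 2 * (b k * T ^ k / (k ! : ℝ))) / b 0, fun θ h0 hle => ?_⟩
  have hp := mem_paramSet_of_le hT h0 hle
  have hs := summable_pow_mul_term h0.le hp.2 2
  constructor
  · rw [memLp_two_iff_integrable_sq (measurable_of_countable _).aestronglyMeasurable]
    exact integrable_law hb h0.le (fun k => by positivity) hs
  · rw [integral_law hb h0.le (fun k => by positivity) hs]
    have h1 : ∑' k : ℕ, (k : ℝ) ^ 2 * (b k * θ ^ k / (k ! : ℝ)) ≤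
        ∑' k : ℕ, (k : ℝ) ^ 2 * (b k * T ^ k / (k ! : ℝ)) := by
      refine hs.tsum_le_tsum (fun k => ?_) (summable_pow_mul_term hT.1.le hT.2 2)
      have := hb k
      gcongr
    have h2 : 0 ≤ ∑' k : ℕ, (k : ℝ) ^ 2 * (b k * T ^ k / (k ! : ℝ)) :=
      tsum_nonneg fun k => mul_nonneg (by positivity) (term_nonneg hb hT.1.le k)
    exact div_le_div₀ h2 h1 hb0 (le_seriesB hb h0.le (summable_term hp))

end Mean

/-! ### Change of parameter and removal of the conditioning -/

theorem restrict_eq_smul_restrict_of_singleton {X : Type*} [MeasurableSpace X] [Countable X]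
    [MeasurableSingletonClass X] {μ ν : Measure X} {r : ℝ≥0∞} {S : Set X}
    (h : ∀ x ∈ S, μ {x} = r * ν {x}) : μ.restrict S = r • ν.restrict S := by
  rw [Measure.ext_iff_singleton]
  intro x
  rw [Measure.smul_apply, Measure.restrict_apply (measurableSet_singleton x),
    Measure.restrict_apply (measurableSet_singleton x), smul_eq_mul]
  by_cases hx : x ∈ S
  · rw [Set.inter_eq_left.2 (Set.singleton_subset_iff.2 hx), h x hx]
  · rw [Set.singleton_inter_eq_empty.2 hx]; simp

theorem cond_eq_cond_of_singleton {X : Type*} [MeasurableSpace X] [Countable X]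
    [MeasurableSingletonClass X] {μ ν : Measure X} {r : ℝ≥0∞} (hr0 : r ≠ 0) (hr : r ≠ ∞)
    {S : Set X} (h : ∀ x ∈ S, μ {x} = r * ν {x}) :
    μ S = r * ν S ∧ ProbabilityTheory.cond μ S = ProbabilityTheory.cond ν S := by
  have h1 := restrict_eq_smul_restrict_of_singleton h
  have h2 : μ S = r * ν S := by
    simpa using congrArg (fun m : Measure X => m Set.univ) h1
  refine ⟨h2, ?_⟩
  rw [ProbabilityTheory.cond, ProbabilityTheory.cond, h1, h2, smul_smul,
    ENNReal.mul_inv (Or.inl hr0) (Or.inl hr), mul_right_comm, ENNReal.inv_mul_cancel hr0 hr,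
    one_mul]

/-- The conditional law given the sum does not depend on the parameter. -/
theorem cond_pi_law_eq {b : ℕ → ℝ} (hb : ∀ k, 0 ≤ b k) (hb0 : 0 < b 0) {θ τ : ℝ} (hθ : 0 < θ)
    (hτ : 0 < τ) (hsθ : Summable fun k : ℕ => b k * θ ^ k / (k ! : ℝ))
    (hsτ : Summable fun k : ℕ => b k * τ ^ k / (k ! : ℝ)) (N n : ℕ) :
    (Measure.pi (fun _ : Fin N => law b τ) (sumEvent N n) ≠ 0 →
      Measure.pi (fun _ : Fin N => law b θ) (sumEvent N n) ≠ 0) ∧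
    ProbabilityTheory.cond (Measure.pi fun _ : Fin N => law b θ) (sumEvent N n) =
      ProbabilityTheory.cond (Measure.pi fun _ : Fin N => law b τ) (sumEvent N n) := by
  have := isProbabilityMeasure_law hb hb0 hθ.le hsθ
  have := isProbabilityMeasure_law hb hb0 hτ.le hsτ
  have hB := hb0.trans_le (le_seriesB hb hθ.le hsθ)
  have hB' := hb0.trans_le (le_seriesB hb hτ.le hsτ)
  -- The likelihood ratio of the two product laws on the event `∑ x_j = n`: it depends on `x` only
  -- through the sum, so it cancels under conditioning.
  set r : ℝ := (θ / τ) ^ n * (seriesB b τ / seriesB b θ) ^ N with hr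
  have hr0 : 0 < r := by positivity
  have hr1 : ENNReal.ofReal r ≠ 0 := (ENNReal.ofReal_pos.2 hr0).ne'
  have h := cond_eq_cond_of_singleton (μ := Measure.pi fun _ : Fin N => law b θ)
    (ν := Measure.pi fun _ : Fin N => law b τ) (S := sumEvent N n) hr1 ENNReal.ofReal_ne_top
    fun x hx => by
      rw [Measure.pi_singleton, Measure.pi_singleton]
      simp_rw [law_singleton]
      rw [← ENNReal.ofReal_prod_of_nonneg fun j _ => weight_nonneg hb hθ.le _,
        ← ENNReal.ofReal_prod_of_nonneg fun j _ => weight_nonneg hb hτ.le _,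
        ← ENNReal.ofReal_mul hr0.le]
      congr 1
      have hx' : ∑ j, x j = n := hx
      have hw : ∀ k, weight b θ k =
          (θ / τ) ^ k * (seriesB b τ / seriesB b θ) * weight b τ k := fun k => by
        have := hτ.ne'
        rw [weight, weight, div_pow]; field_simp
      simp_rw [hw]
      rw [Finset.prod_mul_distrib, Finset.prod_mul_distrib, Finset.prod_pow_eq_pow_sum, hx']
      rw [hr, Finset.prod_const, Finset.card_univ, Fintype.card_fin]
  refine ⟨fun hne => ?_, h.2⟩
  rw [h.1]
  exact mul_ne_zero hr1 hne

/-- Transposing the array of boxes and colours turns it into independent rows, one per colour. -/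
theorem measure_pi_pi_forall_sumEvent {K N : ℕ} (ν : Fin K → Measure ℕ)
    [∀ i, IsProbabilityMeasure (ν i)] (n : Fin K → ℕ) :
    Measure.pi (fun _ : Fin N => Measure.pi ν) {y | ∀ i, ∑ j, y j i = n i} =
      ∏ i, Measure.pi (fun _ : Fin N => ν i) (sumEvent N (n i)) := by
  set W := Measure.pi (fun _ : Fin N => Measure.pi ν)
  have hm : Measurable (Function.swap : (Fin N → Fin K → ℕ) → Fin K → Fin N → ℕ) :=
    measurable_of_countable _
  have hmap : W.map Function.swap = Measure.pi fun i => Measure.pi fun _ : Fin N => ν i := by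
    rw [Measure.ext_iff_singleton]
    intro z
    rw [Measure.map_apply hm (measurableSet_singleton z)]
    have : Function.swap ⁻¹' {z} = {(Function.swap z : Fin N → Fin K → ℕ)} := by
      ext y
      simp only [Set.mem_preimage, Set.mem_singleton_iff]
      constructor <;> (rintro rfl; rfl)
    rw [this]
    simp only [W, Measure.pi_singleton, Function.swap]
    exact Finset.prod_comm
  have : {y : Fin N → Fin K → ℕ | ∀ i, ∑ j, y j i = n i} =
      Function.swap ⁻¹' (Set.univ.pi fun i => sumEvent N (n i)) := by
    ext y; simp [sumEvent, Function.swap]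
  rw [this, ← Measure.map_apply hm (Set.to_countable _).measurableSet, hmap, Measure.pi_pi]

/-- Probabilities in the allocation scheme are controlled by those for independent boxes. -/
theorem IsScheme.measure_le {Ω : Type*} [MeasurableSpace Ω] {P : Measure Ω}
    [IsProbabilityMeasure P] {K N : ℕ} {ρ : Fin K → Fin N → Measure ℕ} {n : Fin K → ℕ}
    {η : Fin N → Ω → (Fin K → ℕ)} (h : IsScheme P ρ n η) (ν : Fin K → Measure ℕ)
    [∀ i, IsProbabilityMeasure (ν i)]
    (hne : ∀ i, Measure.pi (fun _ : Fin N => ν i) (sumEvent N (n i)) ≠ 0)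
    (hcond : ∀ i, ProbabilityTheory.cond (Measure.pi (ρ i)) (sumEvent N (n i)) =
      ProbabilityTheory.cond (Measure.pi fun _ : Fin N => ν i) (sumEvent N (n i)))
    (A : Set (Fin N → Fin K → ℕ)) :
    P {ω | (fun j => η j ω) ∈ A} ≤
      (∏ i, Measure.pi (fun _ : Fin N => ν i) (sumEvent N (n i)))⁻¹ *
        Measure.pi (fun _ : Fin N => Measure.pi ν) A := by
  set W := Measure.pi (fun _ : Fin N => Measure.pi ν)
  set G : Set (Fin N → Fin K → ℕ) := {y | ∀ i, ∑ j, y j i = n i}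
  set c : ℝ≥0∞ := ∏ i, Measure.pi (fun _ : Fin N => ν i) (sumEvent N (n i)) with hc
  have hc0 : c ≠ 0 := Finset.prod_ne_zero_iff.2 fun i _ => hne i
  have hct : c ≠ ∞ := ENNReal.prod_ne_top fun i _ => measure_ne_top _ _
  have hm : Measurable fun ω j => η j ω := measurable_pi_lambda _ h.measurable
  have hms : ∀ B : Set (Fin N → Fin K → ℕ), MeasurableSet B := fun B =>
    (Set.to_countable B).measurableSet
  have : IsProbabilityMeasure (P.map fun ω j => η j ω) :=
    Measure.isProbabilityMeasure_map hm.aemeasurable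
  set H := P.map fun ω j => η j ω
  have hrestr : H.restrict G = c⁻¹ • W.restrict G := by
    refine restrict_eq_smul_restrict_of_singleton fun y hy => ?_
    rw [Measure.map_apply hm (hms _)]
    have e1 : (fun ω j => η j ω) ⁻¹' {y} = {ω | ∀ j, η j ω = y j} := by
      ext ω; simp [funext_iff]
    rw [e1, h.joint_law y hy]
    have e2 : ∀ i, ProbabilityTheory.cond (Measure.pi (ρ i)) (sumEvent N (n i))
        {x | ∀ j, x j = y j i} =
        (Measure.pi (fun _ : Fin N => ν i) (sumEvent N (n i)))⁻¹ * ∏ j, ν i {y j i} := fun i => by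
      rw [hcond, ProbabilityTheory.cond_apply (measurableSet_sumEvent _ _)]
      have e3 : {x : Fin N → ℕ | ∀ j, x j = y j i} = {fun j => y j i} := by
        ext x; simp [funext_iff]
      have e4 : (fun j => y j i) ∈ sumEvent N (n i) := hy i
      rw [e3, Set.inter_eq_right.2 (Set.singleton_subset_iff.2 e4), Measure.pi_singleton]
    simp_rw [e2]
    rw [Finset.prod_mul_distrib, Finset.prod_comm, hc, ENNReal.prod_inv_distrib]
    · simp [W, Measure.pi_singleton]
    · intro i _ j _ _
      exact Or.inr (measure_ne_top _ _)
  have hWG : W G = c := measure_pi_pi_forall_sumEvent ν n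
  -- `joint_law` prescribes the law only on `G`, but the prescribed masses already add up to one, so
  -- nothing is left outside `G`.
  have hHG : H Gᶜ = 0 := by
    rw [prob_compl_eq_zero_iff (hms G)]
    have := congrArg (fun m : Measure _ => m Set.univ) hrestr
    simpa [hWG, ENNReal.inv_mul_cancel hc0 hct] using this
  calc P {ω | (fun j => η j ω) ∈ A} = H A := (Measure.map_apply hm (hms A)).symm
    _ ≤ H.restrict G A + H Gᶜ := by
        rw [Measure.restrict_apply (hms A)]
        exact (measure_mono fun y hy => by
          by_cases hG : y ∈ G
          · exact Or.inl ⟨hy, hG⟩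
          · exact Or.inr hG).trans (measure_union_le _ _)
    _ ≤ c⁻¹ * W A := by
        rw [hHG, add_zero, hrestr, Measure.smul_apply, smul_eq_mul]
        gcongr
        exact Measure.restrict_le_self

/-! ### Uniform bounds and tails over the sector -/

/-- Uniform estimates for one colour: the parameter, the local probability of the sum and the
weight of a fixed point, for means in a compact interval. -/
theorem exists_uniform_bounds {b : ℕ → ℝ} (hb : ∀ k, 0 ≤ b k) (hb0 : 0 < b 0) (hb1 : 0 < b 1)
    {α' α'' : ℝ} (hα' : 0 < α') (hα'' : ∃ t ∈ paramSet b, mean b t = α'') {s : ℕ}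
    (hs : 0 < b s) :
    ∃ c > 0, ∃ N₀ : ℕ, ∀ N ≥ N₀, ∀ n : ℕ, α' < (n : ℝ) / N → (n : ℝ) / N < α'' →
      meanInv b ((n : ℝ) / N) ∈ paramSet b ∧
      1 / (N : ℝ) ≤ sumProb (law b (meanInv b ((n : ℝ) / N))) N n ∧
      c ≤ weight b (meanInv b ((n : ℝ) / N)) s ∧
      weight b (meanInv b ((n : ℝ) / N)) s ≤ 1 - c := by
  obtain ⟨T, hT, rfl⟩ := hα''
  obtain ⟨τ, hτ, hinv⟩ := exists_meanInv_mem_Icc hb hb0 hT hα'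
  obtain ⟨c₀, hc₀, hw₀⟩ := exists_pos_le_weight hb hb0 hT hτ hb0
  obtain ⟨c₁, hc₁, hw₁⟩ := exists_pos_le_weight hb hb0 hT hτ hb1
  obtain ⟨c₂, hc₂, hw₂⟩ := exists_pos_le_weight hb hb0 hT hτ hs
  obtain ⟨V, hV⟩ := exists_integral_sq_le hb hb0 hT
  obtain ⟨N₀, hN₀⟩ := exists_forall_inv_le_sumProb (lt_min hc₀ hc₁) (le_max_left 1 V)
  refine ⟨min (min c₀ c₁) c₂, lt_min (lt_min hc₀ hc₁) hc₂, max N₀ 1, fun N hN n h1 h2 => ?_⟩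
  obtain ⟨hmem, hmean⟩ := hinv _ h1 h2
  set θ := meanInv b ((n : ℝ) / N)
  have hθ0 : 0 < θ := hτ.trans_le hmem.1
  have hθ : θ ∈ paramSet b := mem_paramSet_of_le hT hθ0 hmem.2
  have hsum := summable_term hθ
  have hprob := isProbabilityMeasure_law hb hb0 hθ0.le hsum
  have hHS := hasSum_weight hb hb0 hθ0.le hsum
  have hN1 : (0 : ℝ) < N := by
    have : 1 ≤ N := (le_max_right _ _).trans hN
    exact_mod_cast this
  refine ⟨hθ, ?_, (min_le_right _ _).trans (hw₂ θ hmem), ?_⟩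
  · refine hN₀ N ((le_max_left _ _).trans hN) _ hprob (fun a ha => ?_) (hV θ hθ0 hmem.2).1
      ((hV θ hθ0 hmem.2).2.trans (le_max_right _ _)) n ?_
    · rw [measureReal_law_singleton hb hθ0.le]
      rcases ha with rfl | rfl
      · exact (min_le_left _ _).trans (hw₀ θ hmem)
      · exact (min_le_right _ _).trans (hw₁ θ hmem)
    · change (n : ℝ) = N * mean b θ
      rw [hmean, mul_div_cancel₀ _ hN1.ne']
  -- At least one of the points `0` and `1` differs from `s` and carries mass at least `c`, which
  -- keeps the weight of `s` away from one.
  · have two : ∀ k, k ≠ s → weight b θ k + weight b θ s ≤ 1 := fun k hk => by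
      rw [← hHS.tsum_eq, ← Finset.sum_pair hk]
      exact hHS.summable.sum_le_tsum _ fun j _ => weight_nonneg hb hθ0.le j
    have hmin : min (min c₀ c₁) c₂ ≤ min c₀ c₁ := min_le_left _ _
    by_cases h0 : (0 : ℕ) = s
    · have := two 1 (by omega)
      have := hw₁ θ hmem
      linarith [min_le_right c₀ c₁]
    · have := two 0 h0
      have := hw₀ θ hmem
      linarith [min_le_left c₀ c₁]

theorem IsScheme.measureReal_le {Ω : Type*} [MeasurableSpace Ω] {P : Measure Ω}
    [IsProbabilityMeasure P] {K N : ℕ} (hN : 0 < N) {ρ : Fin K → Fin N → Measure ℕ}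
    {n : Fin K → ℕ} {η : Fin N → Ω → (Fin K → ℕ)} (h : IsScheme P ρ n η) (ν : Fin K → Measure ℕ)
    [∀ i, IsProbabilityMeasure (ν i)] (hsum : ∀ i, 1 / (N : ℝ) ≤ sumProb (ν i) N (n i))
    (hcond : ∀ i, ProbabilityTheory.cond (Measure.pi (ρ i)) (sumEvent N (n i)) =
      ProbabilityTheory.cond (Measure.pi fun _ : Fin N => ν i) (sumEvent N (n i)))
    (A : Set (Fin N → Fin K → ℕ)) :
    P.real {ω | (fun j => η j ω) ∈ A} ≤
      (N : ℝ) ^ K * (Measure.pi (fun _ : Fin N => Measure.pi ν)).real A := by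
  have hN' : (0 : ℝ) < N := by exact_mod_cast hN
  have hpos : ∀ i, 0 < sumProb (ν i) N (n i) := fun i => lt_of_lt_of_le (by positivity) (hsum i)
  have hne : ∀ i, Measure.pi (fun _ : Fin N => ν i) (sumEvent N (n i)) ≠ 0 := fun i h0 =>
    (hpos i).ne' (by rw [sumProb, measureReal_def, h0, ENNReal.toReal_zero])
  have h1 := h.measure_le ν hne hcond A
  have h2 := ENNReal.toReal_mono (ENNReal.mul_ne_top
    (ENNReal.inv_ne_top.2 (Finset.prod_ne_zero_iff.2 fun i _ => hne i)) (measure_ne_top _ _)) h1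
  rw [ENNReal.toReal_mul, ENNReal.toReal_inv, ENNReal.toReal_prod] at h2
  refine h2.trans ?_
  change (∏ i, sumProb (ν i) N (n i))⁻¹ * _ ≤ _
  refine mul_le_mul_of_nonneg_right ?_ measureReal_nonneg
  have h3 : (1 / (N : ℝ)) ^ K ≤ ∏ i, sumProb (ν i) N (n i) := by
    calc (1 / (N : ℝ)) ^ K = ∏ _i : Fin K, 1 / (N : ℝ) := by simp
      _ ≤ _ := Finset.prod_le_prod (fun i _ => by positivity) fun i _ => hsum i
  refine (inv_anti₀ (by positivity) h3).trans ?_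
  simp

theorem abs_integral_sub_le_of_concentrated {X : Type*} [MeasurableSpace X] {μ : Measure X}
    [IsProbabilityMeasure μ] {Z : X → ℝ} (hZ : Measurable Z) {N c d : ℝ} (hZ0 : ∀ x, 0 ≤ Z x)
    (hZN : ∀ x, Z x ≤ N) (hc : 0 ≤ c) (hcN : c ≤ N) (hd : 0 ≤ d) :
    |∫ x, Z x ∂μ - c| ≤ d + N * μ.real {x | d ≤ |Z x - c|} := by
  have h1 := setIntegral_le_of_concentrated (μ := μ) hZ hZ0 hZN hc hd MeasurableSet.univ
  have h2 := le_setIntegral_of_concentrated (μ := μ) hZ hZ0 hZN hcN hd MeasurableSet.univ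
  rw [setIntegral_univ, probReal_univ, mul_one] at h1 h2
  rw [abs_le]
  constructor <;> linarith

/-- The tail of the number of boxes in an allocation scheme. -/
theorem IsScheme.measureReal_boxCount_le {Ω : Type*} [MeasurableSpace Ω] {P : Measure Ω}
    [IsProbabilityMeasure P] {K N : ℕ} (hN : 0 < N) {ρ : Fin K → Fin N → Measure ℕ}
    {n : Fin K → ℕ} {η : Fin N → Ω → (Fin K → ℕ)} (h : IsScheme P ρ n η) (ν : Fin K → Measure ℕ)
    [∀ i, IsProbabilityMeasure (ν i)] (hsum : ∀ i, 1 / (N : ℝ) ≤ sumProb (ν i) N (n i))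
    (hcond : ∀ i, ProbabilityTheory.cond (Measure.pi (ρ i)) (sumEvent N (n i)) =
      ProbabilityTheory.cond (Measure.pi fun _ : Fin N => ν i) (sumEvent N (n i)))
    (s : Fin K → ℕ) {p σ : ℝ} (hp : ∏ i, (ν i).real {s i} = p) (hσ : 0 < σ)
    (hpσ : σ ^ 2 = p * (1 - p)) (hl : √(9 * (K + 1) / 2) * √(Real.log N / N) / σ ≤ 1 / 10) :
    P.real {ω | √(9 * (K + 1) / 2) * √(N * Real.log N) * σ ≤ |boxCount η s ω - N * p|} ≤
      2 / (N : ℝ) ^ (K + 2) := by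
  have hN' : (0 : ℝ) < N := by exact_mod_cast hN
  have hlog : 0 ≤ Real.log N := Real.log_natCast_nonneg N
  set ε := √(9 * (K + 1) / 2) with hε
  have hε2 : ε ^ 2 = 9 * (K + 1) / 2 := Real.sq_sqrt (by positivity)
  -- `l = t / (N σ²)` minimises the quadratic part `-l t + N l² σ² / 2` of the exponent.
  set l := ε * √(Real.log N / N) / σ with hldef
  have hl0 : 0 ≤ l := by positivity
  set t := ε * √(N * Real.log N) * σ
  have hκ : (Measure.pi ν).real {s} = p := by
    rw [← hp, measureReal_def, Measure.pi_singleton, ENNReal.toReal_prod]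
    rfl
  -- `boxCount η s ω` is by definition `hitCount {s}` of the configuration at `ω`.
  have h1 := h.measureReal_le hN ν hsum hcond {y | t ≤ |hitCount {s} y - N * p|}
  have h2 := measureReal_abs_hitCount_sub_ge_le (Measure.pi ν) (measurableSet_singleton s) hl0
    (hl.trans (by norm_num)) N t
  rw [hκ] at h2
  have hlt : l * t = ε ^ 2 * Real.log N := by
    have : √(Real.log N / N) * √(N * Real.log N) = Real.log N := by
      rw [← Real.sqrt_mul (by positivity), ← Real.sqrt_sq hlog]
      congr 1
      rw [Real.sqrt_sq hlog]; field_simp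
    calc l * t = ε ^ 2 * (√(Real.log N / N) * √(N * Real.log N)) := by
          rw [hldef]; simp only [t]; field_simp
      _ = _ := by rw [this]
  have hls : N * (l ^ 2 * (p * (1 - p))) = ε ^ 2 * Real.log N := by
    rw [← hpσ, ← mul_pow, hldef, div_mul_cancel₀ _ hσ.ne', mul_pow,
      Real.sq_sqrt (by positivity : 0 ≤ Real.log N / N)]
    field_simp
  -- The left side is `-ε² log N · (1 - l)/2`. Since `l ≤ 1/10`, the factor `(1 - l)/2` is at least
  -- `0.45`, and `0.45 · 9(K+1)/2 ≥ 2K + 2`.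
  have hexp : -(l * t) + N * (l ^ 2 * (p * (1 - p)) * ((1 + l) / 2)) ≤
      -((2 * K + 2 : ℕ) * Real.log N) := by
    rw [← mul_assoc (N : ℝ), hls, hlt, hε2]
    push_cast
    nlinarith [mul_nonneg (by positivity : (0 : ℝ) ≤ (K : ℝ) + 1) hlog]
  calc P.real {ω | t ≤ |boxCount η s ω - N * p|}
      ≤ (N : ℝ) ^ K * (2 * Real.exp (-((2 * K + 2 : ℕ) * Real.log N))) := by
        refine h1.trans ?_
        gcongr
        exact h2.trans (by gcongr)
    _ = 2 / (N : ℝ) ^ (K + 2) := by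
        rw [Real.exp_neg, Real.exp_nat_mul, Real.exp_log hN']
        have : (2 * K + 2) = K + (K + 2) := by ring
        rw [this, pow_add]
        field_simp

/-- Keeps `σ²` away from zero: the product is at least `∏ c_i`, and a single factor already keeps it
away from one, which is where `K > 0` enters. -/
theorem prod_mul_le_prod_mul_one_sub_prod {K : ℕ} (hK : 0 < K) {w c : Fin K → ℝ} (hc : ∀ i, 0 < c i)
    (hw : ∀ i, c i ≤ w i) (hw1 : ∀ i, w i ≤ 1 - c i) :
    (∏ i, c i) * c ⟨0, hK⟩ ≤ (∏ i, w i) * (1 - ∏ i, w i) := by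
  have h1 : ∏ i, c i ≤ ∏ i, w i := Finset.prod_le_prod (fun i _ => (hc i).le) fun i _ => hw i
  have h2 : ∏ i, w i ≤ w ⟨0, hK⟩ := by
    rw [← Finset.mul_prod_erase _ _ (Finset.mem_univ (⟨0, hK⟩ : Fin K))]
    refine mul_le_of_le_one_right ((hc _).le.trans (hw _)) (Finset.prod_le_one
      (fun i _ => (hc i).le.trans (hw i)) fun i _ => ?_)
    linarith [hw1 i, hc i]
  have h3 : 0 < ∏ i, c i := Finset.prod_pos fun i _ => hc i
  exact mul_le_mul h1 (by linarith [hw1 ⟨0, hK⟩]) (hc _).le (h3.le.trans h1)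

/-- The uniform tail estimate for the box counts in the sector. -/
theorem exists_uniform_tail {Ω : Type*} [MeasurableSpace Ω] (P : Measure Ω)
    [IsProbabilityMeasure P] {K : ℕ} (hK : 0 < K)
    {b : Fin K → ℕ → ℝ} (hb : ∀ i k, 0 ≤ b i k) (hb0 : ∀ i, 0 < b i 0) (hb1 : ∀ i, 0 < b i 1)
    {θ : (Fin K → ℕ) → ℕ → Fin K → ℝ} (hθ : ∀ n N i, 0 < θ n N i)
    (hθB : ∀ n N i, Summable fun k : ℕ => b i k * θ n N i ^ k / (k ! : ℝ))
    {η : (Fin K → ℕ) → (N : ℕ) → Fin N → Ω → (Fin K → ℕ)}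
    (hη : ∀ n N, (∀ i, Measure.pi (fun _ : Fin N => law (b i) (θ n N i))
        (sumEvent N (n i)) ≠ 0) →
      IsScheme P (fun i (_ : Fin N) => law (b i) (θ n N i)) n (η n N))
    {α' α'' : Fin K → ℝ} (hα' : ∀ i, 0 < α' i)
    (hα'' : ∀ i, ∃ t ∈ paramSet (b i), mean (b i) t = α'' i)
    {s : Fin K → ℕ} (hs : ∀ i, 0 < b i (s i)) :
    ∃ σ₀ > 0, ∃ N₀ : ℕ, ∀ N ≥ N₀, ∀ n : Fin K → ℕ,
      (∀ i, α' i < (n i : ℝ) / N ∧ (n i : ℝ) / N < α'' i) →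
      σ₀ ≤ cellSigma b s n N ∧
      P.real {ω | √(9 * (K + 1) / 2) * √(N * Real.log N) * cellSigma b s n N ≤
        |boxCount (η n N) s ω - N * cellProb b s n N|} ≤ 2 / (N : ℝ) ^ (K + 2) ∧
      |∫ ω, boxCount (η n N) s ω ∂P - N * cellProb b s n N| ≤
        √(9 * (K + 1) / 2) * √(N * Real.log N) * cellSigma b s n N + 2 := by
  choose c hc M hM using fun i => exists_uniform_bounds (hb i) (hb0 i) (hb1 i) (hα' i) (hα'' i)
    (hs i)
  set q := (∏ i, c i) * c ⟨0, hK⟩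
  have hq : 0 < q := mul_pos (Finset.prod_pos fun i _ => hc i) (hc _)
  have hsq : Tendsto (fun N : ℕ => √(Real.log N / N)) atTop (nhds 0) := by
    have h1 : Tendsto (fun N : ℕ => Real.log N / N) atTop (nhds 0) :=
      (Real.isLittleO_log_id_atTop.tendsto_div_nhds_zero).comp tendsto_natCast_atTop_atTop
    simpa using h1.sqrt
  have hsq2 : Tendsto (fun N : ℕ => √(9 * (K + 1) / 2) * √(Real.log N / N) / √q) atTop
      (nhds 0) := by
    simpa using (hsq.const_mul √(9 * (K + 1) / 2)).div_const √q
  obtain ⟨N₁, hN₁⟩ := eventually_atTop.1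
    (hsq2.eventually (gt_mem_nhds (by norm_num : (0 : ℝ) < 1 / 10)))
  refine ⟨√q, Real.sqrt_pos.2 hq, max (max N₁ 1) (∑ i, M i), fun N hN n hn => ?_⟩
  have hN1 : N₁ ≤ N := (le_max_left _ _).trans ((le_max_left _ _).trans hN)
  have hNpos : 0 < N := (le_max_right N₁ 1).trans ((le_max_left _ _).trans hN)
  have hMi : ∀ i, M i ≤ N := fun i => (Finset.single_le_sum (fun _ _ => Nat.zero_le _)
    (Finset.mem_univ i)).trans ((le_max_right _ _).trans hN)
  have hcol := fun i => hM i N (hMi i) (n i) (hn i).1 (hn i).2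
  set τ : Fin K → ℝ := fun i => meanInv (b i) ((n i : ℝ) / N)
  have hτ : ∀ i, τ i ∈ paramSet (b i) := fun i => (hcol i).1
  have hprob : ∀ i, IsProbabilityMeasure (law (b i) (τ i)) := fun i =>
    isProbabilityMeasure_law (hb i) (hb0 i) (hτ i).1.le (summable_term (hτ i))
  have hNr : (0 : ℝ) < N := by exact_mod_cast hNpos
  have hsum : ∀ i, 1 / (N : ℝ) ≤ sumProb (law (b i) (τ i)) N (n i) := fun i => (hcol i).2.1
  have hinv := fun i => cond_pi_law_eq (hb i) (hb0 i) (hθ n N i) (hτ i).1 (hθB n N i)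
    (summable_term (hτ i)) N (n i)
  have hscheme := hη n N fun i => (hinv i).1 fun h0 => by
    have h1 := hsum i
    rw [sumProb, measureReal_def, h0, ENNReal.toReal_zero] at h1
    exact absurd h1 (not_le.2 (by positivity))
  have hqle : q ≤ cellProb b s n N * (1 - cellProb b s n N) :=
    prod_mul_le_prod_mul_one_sub_prod hK hc (fun i => (hcol i).2.2.1) fun i => (hcol i).2.2.2
  have hσ : √q ≤ cellSigma b s n N := Real.sqrt_le_sqrt hqle
  have hσ0 : 0 < cellSigma b s n N := (Real.sqrt_pos.2 hq).trans_le hσ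
  have hp : ∏ i, (law (b i) (τ i)).real {s i} = cellProb b s n N :=
    Finset.prod_congr rfl fun i _ => measureReal_law_singleton (hb i) (hτ i).1.le _
  have hp0 : 0 ≤ cellProb b s n N := by
    rw [← hp]; exact Finset.prod_nonneg fun i _ => measureReal_nonneg
  have hp1 : cellProb b s n N ≤ 1 := by
    rw [← hp]; exact Finset.prod_le_one (fun i _ => measureReal_nonneg) fun i _ => measureReal_le_one
  have htail := hscheme.measureReal_boxCount_le hNpos (fun i => law (b i) (τ i)) hsum
    (fun i => (hinv i).2) s hp hσ0 (Real.sq_sqrt (hq.le.trans hqle))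
    ((div_le_div_of_nonneg_left (by positivity) (Real.sqrt_pos.2 hq) hσ).trans (hN₁ N hN1).le)
  refine ⟨hσ, htail, ?_⟩
  have hmeas : Measurable (boxCount (η n N) s) :=
    (measurable_hitCount (measurableSet_singleton s)).comp
      (measurable_pi_lambda (fun ω j => η n N j ω) hscheme.measurable)
  have h := abs_integral_sub_le_of_concentrated (μ := P) hmeas (N := N)
    (c := N * cellProb b s n N)
    (d := √(9 * (K + 1) / 2) * √(N * Real.log N) * cellSigma b s n N)
    (fun ω => hitCount_nonneg {s} fun j => η n N j ω)
    (fun ω => hitCount_le {s} fun j => η n N j ω) (by positivity)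
    (mul_le_of_le_one_right hNr.le hp1) (by positivity)
  refine h.trans (add_le_add_right ?_ _)
  calc (N : ℝ) * _ ≤ N * (2 / (N : ℝ) ^ (K + 2)) := by gcongr
    _ = 2 / (N : ℝ) ^ (K + 1) := by rw [pow_succ _ (K + 1)]; field_simp
    _ ≤ 2 := div_le_self (by norm_num) (one_le_pow₀ (by exact_mod_cast hNpos))

/-! ### Union bound over the sector and Borel–Cantelli -/

theorem exists_nat_forall_lt {K : ℕ} (α : Fin K → ℝ) : ∃ D : ℕ, ∀ i, α i ≤ D := by
  refine ⟨∑ i, ⌈α i⌉₊, fun i => (Nat.le_ceil _).trans ?_⟩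
  exact_mod_cast Finset.single_le_sum (f := fun i => ⌈α i⌉₊) (fun _ _ => Nat.zero_le _)
    (Finset.mem_univ i)

end MultiColour

end

open MultiColour in
theorem theorem1p2 {Ω : Type*} [MeasurableSpace Ω] (P : Measure Ω) [IsProbabilityMeasure P]
    (K : ℕ) (hK : 0 < K)
    -- the coefficient sequences of the power-series distributions
    (b : Fin K → ℕ → ℝ) (hb : ∀ i k, 0 ≤ b i k) (hb0 : ∀ i, 0 < b i 0) (hb1 : ∀ i, 0 < b i 1)
    (hR : ∀ i, 0 < MultiColour.radius (b i))
    -- the parameters of the underlying variables: any for which the series converges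
    (θ : (Fin K → ℕ) → ℕ → Fin K → ℝ) (hθ : ∀ n N i, 0 < θ n N i)
    (hθB : ∀ n N i, Summable fun k : ℕ => b i k * θ n N i ^ k / (k ! : ℝ))
    -- for each `n` and `N` for which the conditioning events have positive probability,
    -- an allocation; nothing is assumed on the joint law for different `(n, N)`
    (η : (Fin K → ℕ) → (N : ℕ) → Fin N → Ω → (Fin K → ℕ))
    (hη : ∀ n N,
      (∀ i, Measure.pi (fun _ : Fin N => MultiColour.law (b i) (θ n N i))
        (MultiColour.sumEvent N (n i)) ≠ 0) →
      MultiColour.IsScheme P (fun i (_ : Fin N) => MultiColour.law (b i) (θ n N i)) n (η n N))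
    -- the sector: `α''_i` is a value of `m_i` on `(0, R_i)`, that is `m_i⁻¹(α''_i) < R_i`
    (α' α'' : Fin K → ℝ) (hα' : ∀ i, 0 < α' i) (hα : ∀ i, α' i < α'' i)
    (hα'' : ∀ i, ∃ t ∈ MultiColour.paramSet (b i), MultiColour.mean (b i) t = α'' i)
    (s : Fin K → ℕ) (hs : ∀ i, 0 < b i (s i)) :
    ∀ᵐ ω ∂P,
      limsup (fun q : (Fin K → ℕ) × ℕ =>
          ((|MultiColour.boxCount (η q.1 q.2) s ω - ∫ ω', MultiColour.boxCount (η q.1 q.2) s ω' ∂P|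
            / (√((q.2 : ℝ) * Real.log (q.2 : ℝ)) * MultiColour.cellSigma b s q.1 q.2) : ℝ) : EReal))
        (MultiColour.sector α' α'')
      ≤ ((4 * √(1 + 3 * (K : ℝ) / 2) : ℝ) : EReal) := by
  obtain ⟨σ₀, hσ₀, N₀, htail⟩ := exists_uniform_tail P hK hb hb0 hb1 hθ hθB hη hα' hα'' hs
  obtain ⟨D, hD⟩ := exists_nat_forall_lt α''
  set ε := √(9 * ((K : ℝ) + 1) / 2) with hε
  set inSector : (Fin K → ℕ) → ℕ → Prop := fun n N =>
    ∀ i, α' i < (n i : ℝ) / N ∧ (n i : ℝ) / N < α'' i with hsec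
  set dev : (Fin K → ℕ) → ℕ → Set Ω := fun n N =>
    {ω | ε * √(N * Real.log N) * cellSigma b s n N ≤
      |boxCount (η n N) s ω - N * cellProb b s n N|} with hdev
  -- All `n` of the sector are gathered for each `N`, so Borel–Cantelli runs over `N` alone. The
  -- conditions on `N` empty the event where the tail bound is unavailable.
  set bad : ℕ → Set Ω := fun N => {ω | N₀ ≤ N ∧ 1 ≤ N ∧ ∃ n, inSector n N ∧ ω ∈ dev n N} with hbad
  have hmeas : ∀ N : ℕ, P (bad N) ≤ ENNReal.ofReal (2 * (D : ℝ) ^ K * (1 / (N : ℝ) ^ 2)) := by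
    intro N
    by_cases hN : N₀ ≤ N ∧ 1 ≤ N
    swap
    · have : bad N = ∅ := by
        ext ω; simp only [hbad, Set.mem_ofPred_eq, Set.mem_empty_iff_false, iff_false]
        exact fun h => hN ⟨h.1, h.2.1⟩
      simp [this]
    have hNr : (0 : ℝ) < N := by exact_mod_cast hN.2
    classical
    set F : Finset (Fin K → ℕ) :=
      (Fintype.piFinset fun _ : Fin K => Finset.range (D * N)).filter fun n => inSector n N
    have hcover : bad N ⊆ ⋃ n ∈ F, dev n N := by
      rintro ω ⟨-, -, n, hn, hω⟩
      simp only [Set.mem_iUnion, exists_prop]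
      refine ⟨n, ?_, hω⟩
      simp only [F, Finset.mem_filter, Fintype.mem_piFinset, Finset.mem_range]
      refine ⟨fun i => ?_, hn⟩
      have h1 := (hn i).2.trans_le (hD i)
      rw [div_lt_iff₀ hNr] at h1
      exact_mod_cast h1
    have hreal : P.real (bad N) ≤ 2 * (D : ℝ) ^ K * (1 / (N : ℝ) ^ 2) := by
      calc P.real (bad N) ≤ P.real (⋃ n ∈ F, dev n N) :=
            measureReal_mono hcover (measure_ne_top _ _)
        _ ≤ ∑ n ∈ F, P.real (dev n N) := measureReal_biUnion_finset_le _ _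
        _ ≤ F.card • (2 / (N : ℝ) ^ (K + 2)) := Finset.sum_le_card_nsmul _ _ _ fun n hn =>
            (htail N hN.1 n (Finset.mem_filter.1 hn).2).2.1
        _ ≤ ((D * N : ℕ) : ℝ) ^ K * (2 / (N : ℝ) ^ (K + 2)) := by
            rw [nsmul_eq_mul]
            gcongr
            have : F.card ≤ (D * N) ^ K :=
              (Finset.card_filter_le _ _).trans (by simp)
            exact_mod_cast this
        _ = _ := by push_cast; rw [mul_pow, pow_add]; field_simp
    rw [← ofReal_measureReal]
    exact ENNReal.ofReal_le_ofReal hreal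
  have hsumm : ∑' N, P (bad N) ≠ ∞ := by
    have h1 : Summable fun N : ℕ => 2 * (D : ℝ) ^ K * (1 / (N : ℝ) ^ 2) :=
      (Real.summable_one_div_nat_pow.2 one_lt_two).mul_left _
    refine ne_top_of_le_ne_top ?_ (ENNReal.tsum_le_tsum hmeas)
    rw [← ENNReal.ofReal_tsum_of_nonneg (fun N => by positivity) h1]
    exact ENNReal.ofReal_ne_top
  -- After squaring and dividing by four this is `18(K + 1) / 4 < 4 + 6K / 1` in the form `ε² < 4 +
  -- 6K`, true since `K ≥ 1`.
  have hgap : 2 * ε < 4 * √(1 + 3 * (K : ℝ) / 2) := by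
    have hK1 : (1 : ℝ) ≤ K := by exact_mod_cast hK
    have : ε < √(4 * (1 + 3 * (K : ℝ) / 2)) := Real.sqrt_lt_sqrt (by positivity) (by linarith)
    rw [Real.sqrt_mul (by norm_num), show (4 : ℝ) = 2 ^ 2 by norm_num,
      Real.sqrt_sq (by norm_num)] at this
    linarith
  have hgrow : Tendsto (fun N : ℕ => √((N : ℝ) * Real.log N)) atTop atTop :=
    Real.tendsto_sqrt_atTop.comp (tendsto_natCast_atTop_atTop.atTop_mul_atTop₀
      (Real.tendsto_log_atTop.comp tendsto_natCast_atTop_atTop))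
  -- The slack `γ` absorbs the additive `2` in the estimate of the expectation once `√(N log N) ≥ 2
  -- / (γ σ₀)`.
  set γ := 4 * √(1 + 3 * (K : ℝ) / 2) - 2 * ε with hγ
  have hγ0 : 0 < γ := sub_pos.2 hgap
  have hlarge := hgrow.eventually_ge_atTop (2 / (γ * σ₀))
  filter_upwards [ae_eventually_notMem hsumm] with ω hω
  refine limsup_le_of_le (by isBoundedDefault) ?_
  rw [sector, eventually_inf_principal]
  have hsnd : Tendsto (Prod.snd : (Fin K → ℕ) × ℕ → ℕ) atTop atTop :=
    (prod_atTop_atTop_eq (α := Fin K → ℕ) (β := ℕ)) ▸ tendsto_snd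
  filter_upwards [hsnd.eventually (hω.and (hlarge.and (eventually_ge_atTop (max N₀ 2))))]
    with ⟨n, N⟩ ⟨h1, h2, h3⟩ hn
  simp only at h1 h2 h3 hn ⊢
  have hN₀ : N₀ ≤ N := (le_max_left _ _).trans h3
  have hN2 : 2 ≤ N := (le_max_right _ _).trans h3
  obtain ⟨hσ, -, hE⟩ := htail N hN₀ n hn
  have hdevn : |boxCount (η n N) s ω - N * cellProb b s n N| <
      ε * √(N * Real.log N) * cellSigma b s n N := by
    by_contra hlt
    exact h1 ⟨hN₀, by omega, n, hn, not_lt.1 hlt⟩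
  have hroot : 0 < √((N : ℝ) * Real.log N) := lt_of_lt_of_le (by positivity) h2
  have hσ0 : 0 < cellSigma b s n N := hσ₀.trans_le hσ
  rw [EReal.coe_le_coe_iff, div_le_iff₀ (mul_pos hroot hσ0)]
  have htri := abs_sub_le (boxCount (η n N) s ω) (N * cellProb b s n N)
    (∫ ω', boxCount (η n N) s ω' ∂P)
  rw [abs_sub_comm (N * cellProb b s n N)] at htri
  have h2' : 2 ≤ γ * (√((N : ℝ) * Real.log N) * cellSigma b s n N) := by
    rw [div_le_iff₀ (by positivity)] at h2
    calc (2 : ℝ) ≤ √((N : ℝ) * Real.log N) * (γ * σ₀) := h2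
      _ ≤ √((N : ℝ) * Real.log N) * (γ * cellSigma b s n N) := by gcongr
      _ = _ := by ring
  rw [hγ] at h2'
  nlinarith
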